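/- A Boolean polynomial in $x_1,\dots,x_n$ is an element of $\mathbb F_2[x_1,\dots,x_n]/\langle x_1^2+x_1,\dots,x_n^2+x_n\rangle$, written as a sum of distinct square-free monomials. The class $\mathrm{cls}(P)$ of $P$ is the largest $c$ such that $x_c$ occurs in $P$ ($0$ for constants); if $c=\mathrm{cls}(P)>0$ and $P=Ix_c+U$ with $x_c$ not in $I,U$, then $I$ is the initial of $P$; $P$ is monic if $I=1$. The degree of a system is the largest total degree of its elements. **The algorithm BCS** (with a threshold $t\in\mathbb N\cup\{\infty\}$ and a function Choose). It keeps a collection of pending systems, at first only the input. As long as there is one, a pending system $\mathbb P$ is removed and TriSet is run on it: zero polynomials are dropped (here and below), $\mathbb A:=\emptyset$, $n_{monic}:=$ the number of monic elements of $\mathbb P$, and then (1)–(3) are repeated. (1) Simplify: as long as $\mathbb P$ contains a linear polynomial $x_c+L$ of class $c$, move it to $\mathbb A$ and replace $x_c$ by $L$ in the other elements of $\mathbb P$; if $1\in\mathbb P$ at any time, this run of TriSet ends. (2) If $n_{monic}\ge t$, apply AddReduce to the set of monic elements of $\mathbb P$. Here AddReduce keeps, for each class, an element $Q$ of lowest total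 degree among those of that class, and replaces every other element $Q'$ of that class by $Q'+Q$; if a sum equals $1$, the run of TriSet ends. (3) If all elements of $\mathbb P$ are monic: when their classes are distinct, output $\mathbb A\cup\mathbb P$ and end the run; otherwise apply AddReduce to $\mathbb P$ (ending the run if a sum equals $1$). If not all are monic: let $P=Ix_c+U$ be the polynomial Choose$(\mathbb P)$, a non-monic element of $\mathbb P$ with $c=\mathrm{cls}(P)$; add $(\mathbb P\setminus\{P\})\cup\mathbb A\cup\{I,U\}$ to the pending systems, replace $\mathbb P$ by $(\mathbb P\setminus\{P\})\cup\{x_c+U,\,I+1\}$ and increase $n_{monic}$ by $1$. The last case of (3) is called a zero decomposition. In the zero decomposition tree the root is the input, and each zero decomposition gives the current node a right child (the new pending system) and a left child (the updated $\mathbb P$), at which the run goes on. A solving branch is a path from the root to a leaf; each run of TriSet ends at a leaf. **Bit cost.** A monomial is a vector of $n$ bits and a polynomial is a sorted list of monomials. Multiplying two monomials costs $n$ bit operations; reading or copying a polynomial with $k$ terms costs $n(k+1)$; adding two polynomials costs the sum of their lengths $n(k+1)$; replacing $x_c$ by $L$ in $Ix_c+U$ costs the computation of the $K=|I|\,|L|$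 products, the sorting of these ($nK(\lceil\log_2K\rceil+1)$), a merge with $U$ ($n(K+|U|)$), and reading the polynomial. Searches (Choose included) and copies of a system cost a pass through it; each use of AddReduce costs, besides its additions, $n+1$ passes through its input; reading or updating the counter $n_{monic}$ costs its bit length plus $1$. **Theorem.** There is an absolute constant $C>0$ such that the following holds for all $n\ge 2$, $d\ge 1$, every system $\mathbb P$ of $m$ Boolean polynomials in $x_1,\dots,x_n$ of degree $d$, and every threshold $t$. Let Choose always pick a polynomial of lowest total degree among the non-monic elements. Consider any execution of BCS on $\mathbb P$ (with arbitrary resolution of the remaining choices) such that in each zero decomposition the initial $I$ of the chosen polynomial is not monic unless $I$ is linear. Then the execution terminates, every branch of the zero decomposition tree has depth at most $(d-1)(n-1)$, there are at most $2^{(d-1)(n-1)}$ branches, and the number of bit operations is at most $$C\cdot 2^{(n-1)(d-1)}\,d\,m\,n^{d+2}\log n .$$ -/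

import Mathlib

namespace BCS

/-! ## Boolean polynomials

An element of `𝔽₂[x₁,…,xₙ]/⟨x₁²+x₁,…,xₙ²+xₙ⟩` is in exactly one way a sum of distinct square-free
monomials.  It is represented by the set of these monomials, and a monomial by the set of the
indices of its variables. -/

/-- A Boolean polynomial: `P` stands for `∑ s ∈ P, ∏ i ∈ s, xᵢ`. -/
abbrev BPoly := Finset (Finset ℕ)

/-- A polynomial system.  It is a list of polynomials up to order (no duplicates are removed). -/
abbrev Sys := Multiset BPoly

/-- The constant `1`.  (The constant `0` is `∅`.) -/
def one : BPoly := {∅}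

/-- The variable `x_c`. -/
def var (c : ℕ) : BPoly := {{c}}

/-- Addition over `𝔽₂`. -/
def add (P Q : BPoly) : BPoly := symmDiff P Q

/-- Multiplication modulo `xᵢ² + xᵢ`: the product of the monomials `s` and `t` is `s ∪ t`, and a
monomial survives if it arises an odd number of times. -/
def mul (P Q : BPoly) : BPoly :=
  ((P ×ˢ Q).image fun st => st.1 ∪ st.2).filter fun u =>
    Odd ((P ×ˢ Q).filter fun st => st.1 ∪ st.2 = u).card

/-- The polynomial `I` in `P = I x_c + U`. -/
def coeffAt (c : ℕ) (P : BPoly) : BPoly := (P.filter fun s => c ∈ s).image fun s => s.erase c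

/-- The polynomial `U` in `P = I x_c + U`. -/
def restAt (c : ℕ) (P : BPoly) : BPoly := P.filter fun s => c ∉ s

/-- The class: the largest `c` such that `x_c` occurs in `P`, and `0` for constants. -/
def cls (P : BPoly) : ℕ := P.sup fun s => s.sup id

/-- The initial: the leading coefficient of `P` as a polynomial in its leading variable. -/
def init (P : BPoly) : BPoly := coeffAt (cls P) P

/-- The total degree (`0` for constants). -/
def tdeg (P : BPoly) : ℕ := P.sup Finset.card

/-- `P` is monic: its initial is `1`. -/
def IsMonic (P : BPoly) : Prop := init P = one

instance : DecidablePred IsMonic := fun P => inferInstanceAs (Decidable (init P = one))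

/-- The highest total degree of the elements of a system. -/
def sysDeg (S : Sys) : ℕ := (S.map tdeg).sup

/-- `S` is a system in the variables `x₁, …, xₙ`. -/
def InVars (n : ℕ) (S : Sys) : Prop := ∀ P ∈ S, ∀ s ∈ P, s ⊆ Finset.Icc 1 n

/-- For a linear polynomial `p = x_c + L` of class `c`: the result of substituting `x_c` by `L`
in `q = I x_c + U`, namely `I L + U`. -/
def subst (p q : BPoly) : BPoly :=
  add (mul (coeffAt (cls p) q) (restAt (cls p) p)) (restAt (cls p) q)

/-! ## Bit costs

A monomial is a vector of `n` bits, and a polynomial is the sorted list of its monomials. -/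

/-- The number of bits of a polynomial (including an end marker); up to a constant factor this is
the cost of reading or copying it, or of finding its class, its total degree and its initial. -/
def bits (n : ℕ) (P : BPoly) : ℕ := n * (P.card + 1)

/-- The cost of one pass through a system. -/
def scan (n : ℕ) (S : Sys) : ℕ := n + (S.map (bits n)).sum

/-- The cost of adding two sorted polynomials: a merge. -/
def addCost (n : ℕ) (P Q : BPoly) : ℕ := bits n P + bits n Q

/-- The cost of computing `I L + U`: with `K = |I| |L|`, there are `K` products of monomials of
`n` bit operations each, `K` monomials of `n` bits are sorted (with cancellation), and the outcome
is merged with `U`. -/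
def substCost (n : ℕ) (p q : BPoly) : ℕ :=
  let K := (coeffAt (cls p) q).card * (restAt (cls p) p).card
  bits n q + n * K + n * K * (Nat.clog 2 K + 1) + n * (K + (restAt (cls p) q).card)

/-! ## The function `AddReduce` -/

/-- `piv` selects for each class that occurs in `Q` an element of `Q` of that class that has the
lowest total degree. -/
def IsPivot (Q : Sys) (piv : ℕ → BPoly) : Prop :=
  ∀ c ∈ Q.map cls, piv c ∈ Q ∧ cls (piv c) = c ∧ ∀ q ∈ Q, cls q = c → tdeg (piv c) ≤ tdeg q

/-- The elements of class `c` of `Q` apart from the pivot. -/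
def others (Q : Sys) (piv : ℕ → BPoly) (c : ℕ) : Sys := (Q.filter fun q => cls q = c).erase (piv c)

/-- In each class the pivot is kept and is added to the others; zero polynomials are dropped. -/
def addReduce (Q : Sys) (piv : ℕ → BPoly) : Sys :=
  ∑ c ∈ (Q.map cls).toFinset,
    (piv c ::ₘ ((others Q piv c).map fun q => add q (piv c)).filter fun q => q ≠ ∅)

/-- One pass through `Q` for each class and one to find the degrees, and the additions. -/
def addReduceCost (n : ℕ) (Q : Sys) (piv : ℕ → BPoly) : ℕ :=
  (n + 1) * scan n Q +
    ∑ c ∈ (Q.map cls).toFinset, ((others Q piv c).map fun q => addCost n q (piv c)).sum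

/-! ## The algorithm as a transition system with a step count -/

inductive Side
  | left
  | right

/-- A node of the zero decomposition tree, given by the path from the root; its depth is its
length. -/
abbrev Node := List Side

/-- The three parts of the body of the main loop of `TriSet`: `Simplify`, the use of `AddReduce`
that depends on the threshold, and the case distinction with the zero decomposition. -/
inductive Phase
  | simplify
  | threshold
  | main

/-- The state of a call of `TriSet`: the node the pointer `M` points to, the current system `P`,
the set `A` of the linear polynomials found so far, and the counter `n_monic`. -/
structure TState where
  node : Node
  P : Sys
  A : Sys
  nMonic : ℕ
  phase : Phase

/-- A configuration of `BCS`: the systems that wait to be treated (with their nodes), the state of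
the current call of `TriSet` if there is one, the solving branches that are finished (one for each
finished call of `TriSet`, given by the path to its last node), the triangular sets found so far,
and the number of bit operations so far. -/
structure Config where
  pending : Multiset (Node × Sys)
  cur : Option TState
  branches : Multiset Node
  output : Multiset Sys
  cost : ℕ

/-- The configuration in which `BCS` starts on the input `F`. -/
def start (F : Sys) : Config := ⟨{([], F)}, none, 0, 0, 0⟩

/-- `BCS` has come to its end. -/
def Config.IsFinal (c : Config) : Prop := c.pending = 0 ∧ c.cur = none

/-- The steps of `BCS` for polynomials in `n` variables, with threshold `t` and with the function
`choose`.  Choices that the algorithm leaves open are left open.  The parameters `W`, `B`, `O`, `k`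
are the pending systems, the finished branches, the output and the cost so far. -/
inductive Step (n : ℕ) (t : ℕ∞) (choose : Sys → BPoly) : Config → Config → Prop
  /-- A pending system is selected and `TriSet` is called on it. -/
  | select (W : Multiset (Node × Sys)) (v : Node) (Q : Sys) (B : Multiset Node) (O : Multiset Sys)
      (k : ℕ) :
      Step n t choose
        ⟨(v, Q) ::ₘ W, none, B, O, k⟩
        ⟨W, some ⟨v, Q.filter fun q => q ≠ ∅, 0, Q.countP IsMonic, .simplify⟩, B, O,
          k + scan n Q⟩
  /-- `Simplify` finds the contradiction `1`, and the branch ends. -/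
  | simplifyContra (W : Multiset (Node × Sys)) (v : Node) (P A : Sys) (i : ℕ) (B : Multiset Node)
      (O : Multiset Sys) (k : ℕ) (h : one ∈ P) :
      Step n t choose
        ⟨W, some ⟨v, P, A, i, .simplify⟩, B, O, k⟩
        ⟨W, none, v ::ₘ B, O, k + scan n P⟩
  /-- `Simplify` finds a linear polynomial `p = x_c + L` and substitutes `x_c` by `L`. -/
  | simplifyLinear (W : Multiset (Node × Sys)) (v : Node) (P A : Sys) (i : ℕ) (B : Multiset Node)
      (O : Multiset Sys) (k : ℕ) (p : BPoly) (h : one ∉ P) (hp : p ∈ P) (hlin : tdeg p = 1) :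
      Step n t choose
        ⟨W, some ⟨v, P, A, i, .simplify⟩, B, O, k⟩
        ⟨W, some ⟨v, ((P.erase p).map (subst p)).filter fun q => q ≠ ∅, p ::ₘ A, i, .simplify⟩, B, O,
          k + scan n P + ((P.erase p).map (substCost n p)).sum⟩
  /-- `Simplify` finds nothing more to do. -/
  | simplifyDone (W : Multiset (Node × Sys)) (v : Node) (P A : Sys) (i : ℕ) (B : Multiset Node)
      (O : Multiset Sys) (k : ℕ) (h : one ∉ P) (hlin : ∀ p ∈ P, tdeg p ≠ 1) :
      Step n t choose
        ⟨W, some ⟨v, P, A, i, .simplify⟩, B, O, k⟩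
        ⟨W, some ⟨v, P, A, i, .threshold⟩, B, O, k + scan n P⟩
  /-- `n_monic < t`. -/
  | thresholdSkip (W : Multiset (Node × Sys)) (v : Node) (P A : Sys) (i : ℕ) (B : Multiset Node)
      (O : Multiset Sys) (k : ℕ) (ht : (i : ℕ∞) < t) :
      Step n t choose
        ⟨W, some ⟨v, P, A, i, .threshold⟩, B, O, k⟩
        ⟨W, some ⟨v, P, A, i, .main⟩, B, O, k + (Nat.size i + 1)⟩
  /-- `n_monic ≥ t`, and `AddReduce`, applied to the monic elements, finds a contradiction. -/
  | thresholdContra (W : Multiset (Node × Sys)) (v : Node) (P A : Sys) (i : ℕ) (B : Multiset Node)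
      (O : Multiset Sys) (k : ℕ) (piv : ℕ → BPoly) (ht : t ≤ (i : ℕ∞))
      (hpiv : IsPivot (P.filter IsMonic) piv) (h : one ∈ addReduce (P.filter IsMonic) piv) :
      Step n t choose
        ⟨W, some ⟨v, P, A, i, .threshold⟩, B, O, k⟩
        ⟨W, none, v ::ₘ B, O,
          k + (Nat.size i + 1) + scan n P + addReduceCost n (P.filter IsMonic) piv⟩
  /-- `n_monic ≥ t`, and `AddReduce` is applied to the monic elements. -/
  | thresholdReduce (W : Multiset (Node × Sys)) (v : Node) (P A : Sys) (i : ℕ) (B : Multiset Node)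
      (O : Multiset Sys) (k : ℕ) (piv : ℕ → BPoly) (ht : t ≤ (i : ℕ∞))
      (hpiv : IsPivot (P.filter IsMonic) piv) (h : one ∉ addReduce (P.filter IsMonic) piv) :
      Step n t choose
        ⟨W, some ⟨v, P, A, i, .threshold⟩, B, O, k⟩
        ⟨W, some ⟨v, (P.filter fun q => ¬ IsMonic q) + addReduce (P.filter IsMonic) piv, A, i, .main⟩,
          B, O, k + (Nat.size i + 1) + scan n P + addReduceCost n (P.filter IsMonic) piv⟩
  /-- All elements are monic and have different classes: a triangular set is returned. -/
  | mainReturn (W : Multiset (Node × Sys)) (v : Node) (P A : Sys) (i : ℕ) (B : Multiset Node)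
      (O : Multiset Sys) (k : ℕ) (hmon : ∀ p ∈ P, IsMonic p) (hcls : (P.map cls).Nodup) :
      Step n t choose
        ⟨W, some ⟨v, P, A, i, .main⟩, B, O, k⟩
        ⟨W, none, v ::ₘ B, (A + P) ::ₘ O, k + scan n P + scan n A⟩
  /-- All elements are monic, some class is repeated, and `AddReduce` finds a contradiction. -/
  | mainContra (W : Multiset (Node × Sys)) (v : Node) (P A : Sys) (i : ℕ) (B : Multiset Node)
      (O : Multiset Sys) (k : ℕ) (piv : ℕ → BPoly) (hmon : ∀ p ∈ P, IsMonic p)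
      (hcls : ¬ (P.map cls).Nodup) (hpiv : IsPivot P piv) (h : one ∈ addReduce P piv) :
      Step n t choose
        ⟨W, some ⟨v, P, A, i, .main⟩, B, O, k⟩
        ⟨W, none, v ::ₘ B, O, k + scan n P + addReduceCost n P piv⟩
  /-- All elements are monic, some class is repeated, and `AddReduce` is applied. -/
  | mainReduce (W : Multiset (Node × Sys)) (v : Node) (P A : Sys) (i : ℕ) (B : Multiset Node)
      (O : Multiset Sys) (k : ℕ) (piv : ℕ → BPoly) (hmon : ∀ p ∈ P, IsMonic p)
      (hcls : ¬ (P.map cls).Nodup) (hpiv : IsPivot P piv) (h : one ∉ addReduce P piv) :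
      Step n t choose
        ⟨W, some ⟨v, P, A, i, .main⟩, B, O, k⟩
        ⟨W, some ⟨v, addReduce P piv, A, i, .simplify⟩, B, O, k + scan n P + addReduceCost n P piv⟩
  /-- The zero decomposition with respect to the chosen polynomial `p = I x_c + U`: the system with
  `I, U` instead of `p`, together with `A`, becomes pending as the right child, and the call goes on
  with `x_c + U, I + 1` instead of `p` at the left child. -/
  | decompose (W : Multiset (Node × Sys)) (v : Node) (P A : Sys) (i : ℕ) (B : Multiset Node)
      (O : Multiset Sys) (k : ℕ) (p : BPoly) (hmon : ¬ ∀ p ∈ P, IsMonic p) (hp : p = choose P) :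
      Step n t choose
        ⟨W, some ⟨v, P, A, i, .main⟩, B, O, k⟩
        ⟨(v ++ [.right], init p ::ₘ restAt (cls p) p ::ₘ (P.erase p + A)) ::ₘ W,
          some ⟨v ++ [.left],
            add (var (cls p)) (restAt (cls p) p) ::ₘ add (init p) one ::ₘ P.erase p,
            A, i + 1, .simplify⟩,
          B, O, k + scan n P + scan n (P + A) + (Nat.size i + 1)⟩

/-- `choose` picks from each system with a non-monic element such an element, and among these one
of the lowest total degree. -/
def IsLowestDegreeChoose (choose : Sys → BPoly) : Prop :=
  ∀ P : Sys, (∃ p ∈ P, ¬ IsMonic p) →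
    choose P ∈ P ∧ ¬ IsMonic (choose P) ∧ ∀ q ∈ P, ¬ IsMonic q → tdeg (choose P) ≤ tdeg q

/-- `e 0, …, e N` is an execution of `BCS` on the input `F`, complete or not. -/
def IsExecution (n : ℕ) (t : ℕ∞) (choose : Sys → BPoly) (F : Sys) (e : ℕ → Config) (N : ℕ) : Prop :=
  e 0 = start F ∧ ∀ i < N, Step n t choose (e i) (e (i + 1))

/-- If the next step is a zero decomposition, then the initial of the chosen polynomial is not
monic, or it is linear (a linear polynomial is always monic). -/
def GenericChoice (choose : Sys → BPoly) (c : Config) : Prop :=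
  ∀ s : TState, c.cur = some s → s.phase = .main → (∃ p ∈ s.P, ¬ IsMonic p) →
    ¬ IsMonic (init (choose s.P)) ∨ tdeg (init (choose s.P)) = 1

end BCS

namespace BCS

/-! Depth. At each moment the linear polynomials found so far (`A`, and the `R` still waiting in the
system) solve for the variables outside a set `V`, and the rest `G` lives in the `w` variables of
`V`. A potential `b` bounds the zero decompositions still possible on a branch (`Budget`): either
`(w - 1) * (d - 1) ≤ b`, or `G` contains a nonconstant `g`, non-monic or linear, with `(w - 2) * (d
- 1) + (tdeg g - 1) ≤ b`. The chosen `p` has degree at most that of any non-monic `g`; its initial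
`I` has smaller degree, and `I` or `I + 1` is the new `g` in the children, so `b` drops by one
(`Splits.decompose`). After at most `d - 1` such drops a linear polynomial appears; eliminating its
variable restores the first alternative with `w - 1` in place of `w`. Non-monic polynomials need two
variables, so the start value is `(n - 1) * (d - 1)`.

Work at a node. Each variable is eliminated at most once. A reduction of an entirely monic system
makes its largest repeated class unique and changes nothing above it, so at most `n` reductions
happen between two eliminations from `V` (`card_class_addReduce_le_one`, `RoundBudget`).

Total cost. Budget `b` forces `w ≤ b / (d - 1) + 2`, so nodes near the bottom of the tree handle
only small polynomials: for `d ≥ 2` a node costs `O(d m n ^ 4 log n)` times a factor `O((7/4) ^ b)`.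
As `7/4 < 2`, the recursion `T (b + 1) = cost (b + 1) + 2 * T b` is dominated by the leaves and
gives `O(2 ^ B)` times that prefactor, where `B = (d - 1) * (n - 1)`. For `d = 1` there is a single
node, of cost `O(m n ^ 3 log n)`. The invariant `ConfigOK` carries all this through an execution by
a potential function, and counts branches by Kraft's inequality with weights `2 ^ (B - depth)`. -/

/-- All variables of `P` lie in `V`. -/
def VarsIn (V : Finset ℕ) (P : BPoly) : Prop := ∀ s ∈ P, s ⊆ V

/-- The number of square-free monomials of degree at most `k` in `w` variables. -/
def monomialCount (w k : ℕ) : ℕ := ∑ i ∈ Finset.range (k + 1), w.choose i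

/-! ### Monomials, degrees and classes. -/

theorem VarsIn.mono {V W : Finset ℕ} {P : BPoly} (h : VarsIn V P) (hVW : V ⊆ W) : VarsIn W P :=
  fun s hs => (h s hs).trans hVW

theorem monomialCount_mono {w w' : ℕ} (h : w ≤ w') (k : ℕ) :
    monomialCount w k ≤ monomialCount w' k :=
  Finset.sum_le_sum fun _ _ => Nat.choose_le_choose _ h

theorem monomialCount_one (w : ℕ) : monomialCount w 1 = w + 1 := by
  simp [monomialCount, Finset.sum_range_succ]; omega

theorem card_le_tdeg {P : BPoly} {s : Finset ℕ} (hs : s ∈ P) : s.card ≤ tdeg P :=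
  Finset.le_sup (f := Finset.card) hs

theorem tdeg_le_iff {P : BPoly} {k : ℕ} : tdeg P ≤ k ↔ ∀ s ∈ P, s.card ≤ k :=
  Finset.sup_le_iff

theorem le_cls {P : BPoly} {s : Finset ℕ} {x : ℕ} (hs : s ∈ P) (hx : x ∈ s) : x ≤ cls P :=
  (Finset.le_sup (f := id) hx).trans (Finset.le_sup (f := fun s : Finset ℕ => s.sup id) hs)

theorem cls_le_iff {P : BPoly} {k : ℕ} : cls P ≤ k ↔ ∀ s ∈ P, ∀ x ∈ s, x ≤ k := by
  simp [cls, Finset.sup_le_iff]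

theorem exists_mem_cls {P : BPoly} (h : 1 ≤ tdeg P) : ∃ s ∈ P, cls P ∈ s := by
  obtain ⟨s, hs, hc⟩ : ∃ s ∈ P, s.Nonempty := by
    by_contra! hne
    have : tdeg P ≤ 0 := tdeg_le_iff.2 fun s hs => by simp [hne s hs]
    omega
  obtain ⟨s', hs', he⟩ := Finset.exists_mem_eq_sup P ⟨s, hs⟩ fun s => s.sup id
  -- The index `0` is not excluded here: if the supremum is attained at the empty monomial, the
  -- class is `0` and the only variable that can occur is `x_0`.
  rcases s'.eq_empty_or_nonempty with h0 | hne
  · obtain ⟨x, hx⟩ := hc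
    have h1 : cls P = 0 := by rw [cls, he, h0]; rfl
    have h2 := le_cls hs hx
    obtain rfl : x = 0 := by omega
    exact ⟨s, hs, h1 ▸ hx⟩
  · obtain ⟨x, hx, hxe⟩ := Finset.exists_mem_eq_sup s' hne id
    refine ⟨s', hs', ?_⟩
    rw [cls, he, hxe]
    exact hx

theorem card_le_monomialCount {V : Finset ℕ} {P : BPoly} {k : ℕ} (hV : VarsIn V P)
    (hk : tdeg P ≤ k) : P.card ≤ monomialCount V.card k := by
  calc P.card ≤ ((Finset.range (k + 1)).biUnion fun i => V.powersetCard i).card := by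
        refine Finset.card_le_card fun s hs => ?_
        simp only [Finset.mem_biUnion, Finset.mem_range, Finset.mem_powersetCard]
        exact ⟨s.card, Nat.lt_succ_of_le (tdeg_le_iff.1 hk s hs), hV s hs, rfl⟩
    _ ≤ ∑ i ∈ Finset.range (k + 1), (V.powersetCard i).card := Finset.card_biUnion_le
    _ = monomialCount V.card k := by simp [monomialCount]

/-! ### Membership in the results of the operations -/

theorem mem_add {P Q : BPoly} {s : Finset ℕ} : s ∈ add P Q ↔ s ∈ P ∧ s ∉ Q ∨ s ∈ Q ∧ s ∉ P :=
  Finset.mem_symmDiff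

theorem mem_or_mem_of_mem_add {P Q : BPoly} {s : Finset ℕ} (h : s ∈ add P Q) : s ∈ P ∨ s ∈ Q := by
  rw [mem_add] at h; tauto

theorem exists_of_mem_mul {P Q : BPoly} {u : Finset ℕ} (h : u ∈ mul P Q) :
    ∃ s ∈ P, ∃ t ∈ Q, s ∪ t = u := by
  simp only [mul, Finset.mem_filter, Finset.mem_image, Finset.mem_product, Prod.exists] at h
  obtain ⟨⟨s, t, ⟨hs, ht⟩, rfl⟩, -⟩ := h
  exact ⟨s, hs, t, ht, rfl⟩

theorem mem_coeffAt {c : ℕ} {P : BPoly} {s : Finset ℕ} :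
    s ∈ coeffAt c P ↔ c ∉ s ∧ insert c s ∈ P := by
  simp only [coeffAt, Finset.mem_image, Finset.mem_filter]
  constructor
  · rintro ⟨t, ⟨ht, hc⟩, rfl⟩
    exact ⟨Finset.notMem_erase _ _, by rwa [Finset.insert_erase hc]⟩
  · rintro ⟨hc, hs⟩
    exact ⟨_, ⟨hs, Finset.mem_insert_self _ _⟩, Finset.erase_insert hc⟩

theorem mem_restAt {c : ℕ} {P : BPoly} {s : Finset ℕ} : s ∈ restAt c P ↔ s ∈ P ∧ c ∉ s :=
  Finset.mem_filter

theorem tdeg_coeffAt_lt {c : ℕ} {P : BPoly} {s : Finset ℕ} (hs : s ∈ coeffAt c P) :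
    s.card + 1 ≤ tdeg P := by
  rw [mem_coeffAt] at hs
  rw [← Finset.card_insert_of_notMem hs.1]
  exact card_le_tdeg hs.2

theorem tdeg_coeffAt_le (c : ℕ) (P : BPoly) : tdeg (coeffAt c P) ≤ tdeg P - 1 :=
  tdeg_le_iff.2 fun _ hs => Nat.le_sub_one_of_lt (tdeg_coeffAt_lt hs)

theorem VarsIn.coeffAt {V : Finset ℕ} {P : BPoly} (h : VarsIn V P) (c : ℕ) :
    VarsIn (V.erase c) (coeffAt c P) := fun s hs x hx => by
  rw [mem_coeffAt] at hs
  refine Finset.mem_erase.2 ⟨fun hxc => hs.1 (hxc ▸ hx), h _ hs.2 (Finset.mem_insert_of_mem hx)⟩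

theorem VarsIn.restAt {V : Finset ℕ} {P : BPoly} (h : VarsIn V P) (c : ℕ) :
    VarsIn (V.erase c) (restAt c P) := fun s hs x hx => by
  rw [mem_restAt] at hs
  exact Finset.mem_erase.2 ⟨fun hxc => hs.2 (hxc ▸ hx), h _ hs.1 hx⟩

theorem VarsIn.add {V : Finset ℕ} {P Q : BPoly} (hP : VarsIn V P) (hQ : VarsIn V Q) :
    VarsIn V (add P Q) := fun s hs => (mem_or_mem_of_mem_add hs).elim (hP s) (hQ s)

theorem tdeg_add_le (P Q : BPoly) : tdeg (add P Q) ≤ max (tdeg P) (tdeg Q) :=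
  tdeg_le_iff.2 fun _ hs => (mem_or_mem_of_mem_add hs).elim
    (fun h => (card_le_tdeg h).trans (le_max_left _ _))
    (fun h => (card_le_tdeg h).trans (le_max_right _ _))

theorem tdeg_restAt_le (c : ℕ) (P : BPoly) : tdeg (restAt c P) ≤ tdeg P :=
  Finset.sup_mono (Finset.filter_subset _ _)

theorem card_restAt_le (c : ℕ) (P : BPoly) : (restAt c P).card ≤ P.card :=
  Finset.card_filter_le _ _

theorem coeffAt_eq_empty {V : Finset ℕ} {P : BPoly} (h : VarsIn V P) {c : ℕ} (hc : c ∉ V) :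
    coeffAt c P = ∅ :=
  Finset.eq_empty_of_forall_notMem fun _ hs =>
    hc (h _ (mem_coeffAt.1 hs).2 (Finset.mem_insert_self _ _))

theorem restAt_eq_self {V : Finset ℕ} {P : BPoly} (h : VarsIn V P) {c : ℕ} (hc : c ∉ V) :
    restAt c P = P :=
  Finset.filter_true_of_mem fun _ hs hcs => hc (h _ hs hcs)

theorem ne_empty_of_tdeg_pos {P : BPoly} (h : 1 ≤ tdeg P) : P ≠ ∅ := by
  rintro rfl
  simp [tdeg] at h

theorem cls_mem {V : Finset ℕ} {P : BPoly} (hP : VarsIn V P) (h : 1 ≤ tdeg P) : cls P ∈ V := by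
  obtain ⟨s, hs, hc⟩ := exists_mem_cls h
  exact hP s hs hc

/-! ### Substitution -/

/-- A right child inherits `A` and has to eliminate its variables again; this shows that `G` is not
affected. -/
theorem subst_eq_self {V : Finset ℕ} {p q : BPoly} (h : VarsIn V q) (hc : cls p ∉ V) :
    subst p q = q := by
  rw [subst, coeffAt_eq_empty h hc, restAt_eq_self h hc]
  simp [mul, add]

theorem VarsIn.subst {V : Finset ℕ} {p q : BPoly} (hp : VarsIn V p) (hq : VarsIn V q) :
    VarsIn (V.erase (cls p)) (subst p q) := by
  refine VarsIn.add (fun u hu => ?_) (hq.restAt _)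
  obtain ⟨s, hs, t, ht, rfl⟩ := exists_of_mem_mul hu
  exact Finset.union_subset (hq.coeffAt _ s hs) (hp.restAt _ t ht)

/-- A monomial of `I` has lost `x_c` and regains at most one variable from `L`. -/
theorem tdeg_subst_le {p q : BPoly} (hp : tdeg p = 1) : tdeg (subst p q) ≤ tdeg q := by
  refine tdeg_le_iff.2 fun u hu => ?_
  rcases mem_or_mem_of_mem_add hu with hu | hu
  · obtain ⟨s, hs, t, ht, rfl⟩ := exists_of_mem_mul hu
    have h1 := tdeg_coeffAt_lt hs
    have h2 := card_le_tdeg (mem_restAt.1 ht).1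
    have h3 := Finset.card_union_le s t
    omega
  · exact card_le_tdeg (mem_restAt.1 hu).1

theorem singleton_cls_mem {P : BPoly} (h : tdeg P = 1) : {cls P} ∈ P := by
  obtain ⟨s, hs, hc⟩ := exists_mem_cls h.ge
  have : s.card ≤ 1 := h ▸ card_le_tdeg hs
  obtain ⟨x, rfl⟩ : ∃ x, s = {x} := Finset.card_eq_one.1
    (this.antisymm (Finset.card_pos.2 ⟨_, hc⟩))
  rwa [Finset.mem_singleton.1 hc]

/-- If `x_c` occurs in `r` at all, then `c` lies below the class of `r`, and the variables of `L`
lie below `c`; so the leading variable of `r` survives. This keeps the classes of `A + R` distinct.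
-/
theorem subst_linear {p r : BPoly} (hp : tdeg p = 1) (hr : tdeg r = 1) (hne : cls r ≠ cls p) :
    cls (subst p r) = cls r ∧ tdeg (subst p r) = 1 := by
  have key : ∀ u ∈ mul (coeffAt (cls p) r) (restAt (cls p) p),
      ∀ x ∈ u, x < cls p ∧ cls p ≤ cls r := by
    intro u hu x hx
    obtain ⟨s, hs, t, ht, rfl⟩ := exists_of_mem_mul hu
    have h1 := tdeg_coeffAt_lt hs
    obtain rfl : s = ∅ := Finset.card_eq_zero.1 (by omega)
    rw [Finset.empty_union] at hx
    rw [mem_restAt] at ht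
    refine ⟨lt_of_le_of_ne (le_cls ht.1 hx) fun h => ht.2 (h ▸ hx),
      le_cls (mem_coeffAt.1 hs).2 (Finset.mem_insert_self _ _)⟩
  have hmem : {cls r} ∈ subst p r := by
    refine mem_add.2 (Or.inr ⟨mem_restAt.2 ⟨singleton_cls_mem hr, by simpa using hne.symm⟩, ?_⟩)
    intro h
    have := key _ h _ (Finset.mem_singleton_self _)
    omega
  refine ⟨le_antisymm (cls_le_iff.2 fun s hs x hx => ?_)
    (le_cls hmem (Finset.mem_singleton_self _)), ?_⟩
  · rcases mem_or_mem_of_mem_add hs with h | h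
    · have := key _ h x hx
      omega
    · exact le_cls (mem_restAt.1 h).1 hx
  · have h1 := card_le_tdeg hmem
    have h2 := tdeg_subst_le (q := r) hp
    simp at h1
    omega

/-! ### Monic polynomials and initials -/

theorem IsMonic.eq_singleton {q : BPoly} (hq : IsMonic q) {s : Finset ℕ} (hs : s ∈ q)
    (hc : cls q ∈ s) : s = {cls q} := by
  have h : s.erase (cls q) ∈ init q :=
    mem_coeffAt.2 ⟨Finset.notMem_erase _ _, by rwa [Finset.insert_erase hc]⟩
  rw [hq, one, Finset.mem_singleton] at h
  rw [← Finset.insert_erase hc, h]; rfl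

theorem IsMonic.singleton_mem {q : BPoly} (hq : IsMonic q) : {cls q} ∈ q := by
  have h : ∅ ∈ init q := by rw [hq]; simp [one]
  exact (mem_coeffAt.1 h).2

/-- In a monic polynomial of class `c` the only monomial containing `x_c` is `x_c` itself, and these
cancel. -/
theorem cls_add_lt {p q : BPoly} (hp : IsMonic p) (hq : IsMonic q) (h : cls p = cls q)
    (hpos : 0 < cls q) : cls (add p q) < cls q := by
  refine Nat.lt_of_le_pred hpos (cls_le_iff.2 fun s hs x hx => Nat.le_pred_of_lt ?_)
  have hle : ∀ x ∈ s, x ≤ cls q := fun x hx => (mem_or_mem_of_mem_add hs).elim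
    (fun h' => h ▸ le_cls h' hx) (fun h' => le_cls h' hx)
  refine lt_of_le_of_ne (hle x hx) ?_
  rintro rfl
  rw [mem_add] at hs
  have h1 := hp.singleton_mem
  have h2 := hq.singleton_mem
  rw [h] at h1
  rcases hs with hs | hs
  · obtain rfl := h ▸ IsMonic.eq_singleton hp hs.1 (h ▸ hx)
    exact hs.2 h2
  · obtain rfl := IsMonic.eq_singleton hq hs.1 hx
    exact hs.2 h1

theorem IsMonic.tdeg_pos {q : BPoly} (hq : IsMonic q) : 1 ≤ tdeg q := by
  simpa using card_le_tdeg hq.singleton_mem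

/-- A nonconstant polynomial has positive degree. -/
theorem tdeg_pos_of_ne {P : BPoly} (h0 : P ≠ ∅) (h1 : P ≠ one) : 1 ≤ tdeg P := by
  by_contra! h
  have h2 : ∀ s ∈ P, s = ∅ := fun s hs => by
    have := card_le_tdeg hs
    exact Finset.card_eq_zero.1 (by omega)
  exact (Finset.subset_singleton_iff.1 fun s hs => Finset.mem_singleton.2 (h2 s hs)).elim h0 h1

theorem init_ne_empty {P : BPoly} (h : 1 ≤ tdeg P) : init P ≠ ∅ := by
  obtain ⟨s, hs, hc⟩ := exists_mem_cls h
  refine Finset.ne_empty_of_mem (a := s.erase (cls P)) (mem_coeffAt.2 ⟨by simp, ?_⟩)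
  rwa [Finset.insert_erase hc]

theorem tdeg_init_pos {P : BPoly} (h : 1 ≤ tdeg P) (hm : ¬ IsMonic P) : 1 ≤ tdeg (init P) :=
  tdeg_pos_of_ne (init_ne_empty h) hm

theorem tdeg_init_lt {P : BPoly} (h : 1 ≤ tdeg P) : tdeg (init P) + 1 ≤ tdeg P := by
  have := tdeg_coeffAt_le (cls P) P
  rw [init]
  omega

theorem mem_add_one {P : BPoly} {s : Finset ℕ} (hs : s.Nonempty) : s ∈ add P one ↔ s ∈ P := by
  simp [mem_add, one, hs.ne_empty]

theorem tdeg_add_one (P : BPoly) : tdeg (add P one) = tdeg P := by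
  refine le_antisymm (tdeg_le_iff.2 fun s hs => ?_) (tdeg_le_iff.2 fun s hs => ?_) <;>
  rcases s.eq_empty_or_nonempty with rfl | hne <;> try simp
  · exact card_le_tdeg ((mem_add_one hne).1 hs)
  · exact card_le_tdeg ((mem_add_one hne).2 hs)

theorem cls_add_one (P : BPoly) : cls (add P one) = cls P := by
  refine le_antisymm (cls_le_iff.2 fun s hs x hx => ?_) (cls_le_iff.2 fun s hs x hx => ?_)
  · exact le_cls ((mem_add_one ⟨x, hx⟩).1 hs) hx
  · exact le_cls ((mem_add_one ⟨x, hx⟩).2 hs) hx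

/-- The constant monomial plays no role for the leading variable. Hence `I + 1` serves the left
child as `I` serves the right one. -/
theorem isMonic_add_one (P : BPoly) : IsMonic (add P one) ↔ IsMonic P := by
  have : init (add P one) = init P := by
    ext s
    rw [init, init, cls_add_one, mem_coeffAt, mem_coeffAt,
      mem_add_one (Finset.insert_nonempty _ _)]
  rw [IsMonic, this, IsMonic]

theorem VarsIn.tdeg_le_card {V : Finset ℕ} {P : BPoly} (hP : VarsIn V P) : tdeg P ≤ V.card :=
  tdeg_le_iff.2 fun s hs => Finset.card_le_card (hP s hs)

theorem cls_singleton_add_ne_empty (c : ℕ) (P : BPoly) : add (var c) (restAt c P) ≠ ∅ := by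
  refine Finset.ne_empty_of_mem (a := {c}) (mem_add.2 (Or.inl ⟨by simp [var], ?_⟩))
  simp [mem_restAt]

/-! ### Cost bounds -/

theorem monomialCount_pos (w k : ℕ) : 1 ≤ monomialCount w k := by
  simp [monomialCount, Finset.sum_range_succ']

theorem sum_map_le {S : Sys} {f : BPoly → ℕ} {x M : ℕ} (h : ∀ q ∈ S, f q ≤ x)
    (hM : Multiset.card S ≤ M) : (S.map f).sum ≤ M * x := by
  have := Multiset.sum_le_card_nsmul (S.map f) x (by simpa using h)
  rw [Multiset.card_map, smul_eq_mul] at this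
  exact this.trans (Nat.mul_le_mul_right _ hM)

theorem bits_le {n k : ℕ} {q : BPoly} (h : q.card ≤ k) : bits n q ≤ n * (k + 1) :=
  Nat.mul_le_mul_left _ (by omega)

/-- Bound for the cost of a substitution in a polynomial with at most `T` terms for which at most
`K` products are computed. -/
def substBound (n T K : ℕ) : ℕ :=
  n * (T + 1) + n * K + n * K * (Nat.clog 2 K + 1) + n * (K + T)

theorem substCost_le {n T k l : ℕ} {p q : BPoly} (hq : q.card ≤ T)
    (hk : (coeffAt (cls p) q).card ≤ k) (hl : p.card ≤ l) :
    substCost n p q ≤ substBound n T (k * l) := by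
  have hK : (coeffAt (cls p) q).card * (restAt (cls p) p).card ≤ k * l :=
    Nat.mul_le_mul hk ((card_restAt_le _ _).trans hl)
  have hU : (restAt (cls p) q).card ≤ T := (card_restAt_le _ _).trans hq
  unfold substCost substBound bits
  dsimp only
  gcongr

/-! ### `AddReduce` -/

theorem pivot_mem {Q : Sys} {piv : ℕ → BPoly} (h : IsPivot Q piv) {c : ℕ}
    (hc : c ∈ (Q.map cls).toFinset) : piv c ∈ Q.filter fun q => cls q = c := by
  have := h c (Multiset.mem_toFinset.1 hc)
  simp [this.1, this.2.1]

theorem card_others {Q : Sys} {piv : ℕ → BPoly} (h : IsPivot Q piv) {c : ℕ}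
    (hc : c ∈ (Q.map cls).toFinset) :
    Multiset.card (others Q piv c) + 1 = Multiset.card (Q.filter fun q => cls q = c) := by
  rw [others, ← Multiset.card_cons, Multiset.cons_erase (pivot_mem h hc)]

theorem sum_card_class (Q : Sys) :
    ∑ c ∈ (Q.map cls).toFinset, Multiset.card (Q.filter fun q => cls q = c) = Multiset.card Q := by
  rw [← Multiset.card_map cls Q, ← Multiset.toFinset_sum_count_eq]
  exact Finset.sum_congr rfl fun c _ => by
    rw [Multiset.count_map, Multiset.filter_congr fun q _ => eq_comm]

theorem mem_addReduce {Q : Sys} {piv : ℕ → BPoly} (h : IsPivot Q piv) {g : BPoly}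
    (hg : g ∈ addReduce Q piv) : g ∈ Q ∨
      ∃ q ∈ Q, ∃ p ∈ Q, cls p = cls q ∧ tdeg p ≤ tdeg q ∧ g = add q p ∧ g ≠ ∅ ∧
        2 ≤ Multiset.card (Q.filter fun r => cls r = cls q) := by
  rw [addReduce, Multiset.mem_sum] at hg
  obtain ⟨c, hc, hg⟩ := hg
  have hp := h c (Multiset.mem_toFinset.1 hc)
  rcases Multiset.mem_cons.1 hg with rfl | hg
  · exact Or.inl hp.1
  · right
    simp only [Multiset.mem_filter, Multiset.mem_map] at hg
    obtain ⟨⟨q, hq, rfl⟩, hne⟩ := hg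
    have hq' := Multiset.mem_filter.1 (Multiset.mem_of_mem_erase hq)
    refine ⟨q, hq'.1, piv c, hp.1, by rw [hp.2.1, hq'.2], hp.2.2 q hq'.1 hq'.2, rfl, hne, ?_⟩
    rw [hq'.2, ← card_others h hc]
    have : 0 < Multiset.card (others Q piv c) := Multiset.card_pos_iff_exists_mem.2 ⟨q, hq⟩
    omega

theorem card_addReduce_le {Q : Sys} {piv : ℕ → BPoly} (h : IsPivot Q piv) :
    Multiset.card (addReduce Q piv) ≤ Multiset.card Q := by
  rw [addReduce, Multiset.card_sum, ← sum_card_class Q]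
  refine Finset.sum_le_sum fun c hc => ?_
  rw [Multiset.card_cons, ← card_others h hc]
  have := Multiset.card_le_card (Multiset.filter_le (fun q : BPoly => q ≠ ∅)
    ((others Q piv c).map fun q => add q (piv c)))
  rw [Multiset.card_map] at this
  omega

/-- Each polynomial belongs to one class only, so there are at most `M` additions over all classes.
-/
theorem addReduceCost_le {n T M : ℕ} {Q : Sys} {piv : ℕ → BPoly} (h : IsPivot Q piv)
    (hT : ∀ q ∈ Q, q.card ≤ T) (hM : Multiset.card Q ≤ M) :
    addReduceCost n Q piv ≤ (n + 1) * (n + M * (n * (T + 1))) + M * (2 * (n * (T + 1))) := by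
  unfold addReduceCost scan
  refine Nat.add_le_add (Nat.mul_le_mul_left _
    (Nat.add_le_add_left (sum_map_le (fun q hq => bits_le (hT q hq)) hM) _)) ?_
  calc _ ≤ ∑ c ∈ (Q.map cls).toFinset,
        Multiset.card (Q.filter fun q => cls q = c) * (2 * (n * (T + 1))) := by
        refine Finset.sum_le_sum fun c hc => sum_map_le (fun q hq => ?_)
          (by have := card_others h hc; omega)
        have hq' := Multiset.mem_filter.1 (Multiset.mem_of_mem_erase hq)
        have h1 := bits_le (n := n) (hT q hq'.1)
        have h2 := bits_le (n := n) (hT _ (Multiset.mem_filter.1 (pivot_mem h hc)).1)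
        unfold addCost
        omega
    _ = Multiset.card Q * (2 * (n * (T + 1))) := by rw [← Finset.sum_mul, sum_card_class]
    _ ≤ _ := Nat.mul_le_mul_right _ hM

/-- Above the largest class that occurs twice, `AddReduce` leaves a monic system unchanged, and this
class occurs only once in the result. -/
theorem card_class_addReduce_le_one {Q : Sys} {piv : ℕ → BPoly} (h : IsPivot Q piv)
    (hmon : ∀ q ∈ Q, IsMonic q) (hpos : ∀ q ∈ Q, 0 < cls q) {j : ℕ}
    (hj : ∀ c > j, Multiset.card (Q.filter fun q => cls q = c) ≤ 1) {c : ℕ} (hc : j ≤ c) :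
    Multiset.card ((addReduce Q piv).filter fun q => cls q = c) ≤ 1 := by
  rw [← Multiset.countP_eq_card_filter, addReduce, ← Multiset.coe_countPAddMonoidHom, map_sum]
  calc _ = ∑ e ∈ (Q.map cls).toFinset, if e = c then 1 else 0 := by
        refine Finset.sum_congr rfl fun e he => ?_
        have hp := h e (Multiset.mem_toFinset.1 he)
        -- A sum formed in class `e` has class below `e`, and sums are formed only for `e ≤ j ≤ c`;
        -- so only the pivot of class `c` can count.
        have h0 : Multiset.countP (fun q => cls q = c)
            (((others Q piv e).map fun q => add q (piv e)).filter fun q => q ≠ ∅) = 0 := by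
          refine Multiset.countP_eq_zero.2 fun g hg hgc => ?_
          simp only [Multiset.mem_filter, Multiset.mem_map] at hg
          obtain ⟨⟨q, hq, rfl⟩, -⟩ := hg
          have hq' := Multiset.mem_filter.1 (Multiset.mem_of_mem_erase hq)
          have h1 : 0 < Multiset.card (others Q piv e) := Multiset.card_pos_iff_exists_mem.2 ⟨q, hq⟩
          have h2 := card_others h he
          have h3 : e ≤ j := by
            by_contra! hlt
            have := hj e hlt
            omega
          have h4 := cls_add_lt (hmon q hq'.1) (hmon _ hp.1) (by rw [hp.2.1, hq'.2]) (hpos _ hp.1)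
          rw [hp.2.1] at h4
          omega
        rw [Multiset.coe_countPAddMonoidHom, Multiset.countP_cons, h0, hp.2.1, zero_add]
    _ ≤ 1 := by
        rw [Finset.sum_ite_eq']
        split_ifs <;> omega

theorem exists_isPivot (Q : Sys) : ∃ piv, IsPivot Q piv := by
  have : ∀ c, ∃ p, c ∈ Q.map cls →
      p ∈ Q ∧ cls p = c ∧ ∀ q ∈ Q, cls q = c → tdeg p ≤ tdeg q := by
    intro c
    by_cases hc : c ∈ Q.map cls
    · obtain ⟨p, hp, hmin⟩ := (Q.filter fun q => cls q = c).toFinset.exists_min_image tdeg (by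
        obtain ⟨q, hq, rfl⟩ := Multiset.mem_map.1 hc
        exact ⟨q, by simp [hq]⟩)
      simp only [Multiset.mem_toFinset, Multiset.mem_filter] at hp hmin
      exact ⟨p, fun _ => ⟨hp.1, hp.2, fun q hq hqc => hmin q ⟨hq, hqc⟩⟩⟩
    · exact ⟨∅, fun h => absurd h hc⟩
  choose piv hpiv using this
  exact ⟨piv, hpiv⟩

/-! ### Progress of the algorithm. -/

/-- Only a final configuration is stuck. -/
theorem isFinal_or_exists_step (n : ℕ) (t : ℕ∞) (choose : Sys → BPoly) (c : Config) :
    c.IsFinal ∨ ∃ c', Step n t choose c c' := by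
  obtain ⟨W, cur, B, O, k⟩ := c
  rcases cur with _ | ⟨v, P, A, i, ph⟩
  · induction W using Multiset.induction_on with
    | empty => exact Or.inl ⟨rfl, rfl⟩
    | cons x W _ => exact Or.inr ⟨_, .select W x.1 x.2 B O k⟩
  right
  cases ph with
  | simplify =>
    by_cases h : one ∈ P
    · exact ⟨_, .simplifyContra W v P A i B O k h⟩
    by_cases hl : ∀ p ∈ P, tdeg p ≠ 1
    · exact ⟨_, .simplifyDone W v P A i B O k h hl⟩
    push Not at hl
    obtain ⟨p, hp, hl⟩ := hl
    exact ⟨_, .simplifyLinear W v P A i B O k p h hp hl⟩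
  | threshold =>
    rcases lt_or_ge (i : ℕ∞) t with ht | ht
    · exact ⟨_, .thresholdSkip W v P A i B O k ht⟩
    obtain ⟨piv, hpiv⟩ := exists_isPivot (P.filter IsMonic)
    by_cases h : one ∈ addReduce (P.filter IsMonic) piv
    · exact ⟨_, .thresholdContra W v P A i B O k piv ht hpiv h⟩
    · exact ⟨_, .thresholdReduce W v P A i B O k piv ht hpiv h⟩
  | main =>
    by_cases hmon : ∀ p ∈ P, IsMonic p
    · by_cases hcls : (P.map cls).Nodup
      · exact ⟨_, .mainReturn W v P A i B O k hmon hcls⟩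
      obtain ⟨piv, hpiv⟩ := exists_isPivot P
      by_cases h : one ∈ addReduce P piv
      · exact ⟨_, .mainContra W v P A i B O k piv hmon hcls hpiv h⟩
      · exact ⟨_, .mainReduce W v P A i B O k piv hmon hcls hpiv h⟩
    · exact ⟨_, .decompose W v P A i B O k _ hmon rfl⟩

/-- With this, the cost bound also bounds the number of steps, which gives termination. -/
theorem Step.cost_lt {n : ℕ} {t : ℕ∞} {choose : Sys → BPoly} {c c' : Config} (hn : 1 ≤ n)
    (h : Step n t choose c c') : c.cost + 1 ≤ c'.cost := by
  cases h <;> simp only [scan] <;> omega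

/-! ### The shape of the systems during a run of `TriSet` -/

/-- The system `R + G` together with the linear polynomials `A` found so far: `A` and `R` are linear
and their classes are exactly the variables outside of `V`, and `G` contains only variables of
`V`. -/
structure Splits (n d M : ℕ) (V : Finset ℕ) (A R G : Sys) : Prop where
  subset : V ⊆ Finset.Icc 1 n
  cls_eq : (A + R).map cls = (Finset.Icc 1 n \ V).val
  linear : ∀ p ∈ A + R, tdeg p = 1 ∧ VarsIn (Finset.Icc 1 n) p
  varsIn : ∀ g ∈ G, VarsIn V g ∧ tdeg g ≤ d
  card_le : Multiset.card G ≤ M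

/-- With budget `b`, a system in `w` variables may still undergo `b` zero decompositions on a
branch. -/
def Budget (d w b : ℕ) (G : Sys) : Prop :=
  (w - 1) * (d - 1) ≤ b ∨
    ∃ g ∈ G, 1 ≤ tdeg g ∧ (¬ IsMonic g ∨ tdeg g = 1) ∧ (w - 2) * (d - 1) + (tdeg g - 1) ≤ b

/-- At most `ρ` reductions of an entirely monic system are still possible at the present node. -/
def RoundBudget (n d w ρ : ℕ) (G : Sys) : Prop :=
  2 ≤ d → n * w ≤ ρ ∧ ((∃ g ∈ G, ¬ IsMonic g) ∨
    ∃ j, n * w + j ≤ ρ ∧ ∀ c > j, Multiset.card (G.filter fun g => cls g = c) ≤ 1)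

/-- Common consequence of both alternatives, and all that the cost estimates need: a small budget
means few variables. -/
theorem Budget.width {d w b : ℕ} {G : Sys} (h : Budget d w b G) : (w - 2) * (d - 1) ≤ b := by
  rcases h with h | ⟨g, -, -, -, h⟩
  · exact (Nat.mul_le_mul_right _ (by omega)).trans h
  · omega

theorem Budget.of_mem {d w b : ℕ} {G G' : Sys} (h : Budget d w b G)
    (hG : ∀ g ∈ G, 1 ≤ tdeg g → (¬ IsMonic g ∨ tdeg g = 1) → g ∈ G') : Budget d w b G' := by
  rcases h with h | ⟨g, hg, h1, h2, h3⟩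
  · exact Or.inl h
  · exact Or.inr ⟨g, hG g hg h1 h2, h1, h2, h3⟩

section Splits

variable {n d M : ℕ} {V : Finset ℕ} {A R G : Sys}

theorem Splits.card_add (h : Splits n d M V A R G) :
    Multiset.card A + Multiset.card R + V.card = n := by
  have h1 := congrArg Multiset.card h.cls_eq
  rw [Multiset.card_map, Multiset.card_add, ← Finset.card_def,
    Finset.card_sdiff_of_subset h.subset] at h1
  have h2 := Finset.card_le_card h.subset
  simp at h1 h2
  omega

theorem Splits.replace (h : Splits n d M V A R G) {M' : ℕ} {G' : Sys}
    (hG : ∀ g ∈ G', VarsIn V g ∧ tdeg g ≤ d) (hM : Multiset.card G' ≤ M') :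
    Splits n d M' V A R G' :=
  ⟨h.subset, h.cls_eq, h.linear, hG, hM⟩

/-- Fresh start with `j = n`: no class exceeds `n`. -/
theorem Splits.roundBudget (h : Splits n d M V A R G) {ρ : ℕ}
    (hρ : 2 ≤ d → n * V.card + n ≤ ρ) : RoundBudget n d V.card ρ G := fun hd => by
  have := hρ hd
  refine ⟨by omega, Or.inr ⟨n, this, fun c hc => ?_⟩⟩
  rw [Multiset.filter_eq_nil.2]
  · simp
  · rintro g hg rfl
    exact absurd hc (not_lt.2 (cls_le_iff.2 fun s hs x hx =>
      (Finset.mem_Icc.1 (h.subset ((h.varsIn g hg).1 s hs hx))).2))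

theorem Splits.cls_pos (h : Splits n d M V A R G) {g : BPoly} (hg : g ∈ G) (hd : 1 ≤ tdeg g) :
    0 < cls g :=
  (Finset.mem_Icc.1 (h.subset (cls_mem (h.varsIn g hg).1 hd))).1

theorem Splits.card_linear_le (h : Splits n d M V A R G) {p : BPoly} (hp : p ∈ A + R) :
    p.card ≤ n + 1 := by
  have := card_le_monomialCount (h.linear p hp).2 (h.linear p hp).1.le
  rwa [Nat.card_Icc, Nat.add_sub_cancel, monomialCount_one] at this

theorem Splits.card_le_of_mem (h : Splits n d M V A R G) {w : ℕ} (hw : V.card ≤ w) {g : BPoly}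
    (hg : g ∈ G) : g.card ≤ monomialCount w d :=
  (card_le_monomialCount (h.varsIn g hg).1 (h.varsIn g hg).2).trans (monomialCount_mono hw d)

theorem Splits.cls_ne (h : Splits n d M V A R G) {p r : BPoly} (hp : p ∈ R) (hr : r ∈ R.erase p) :
    cls r ≠ cls p := by
  have hnd : (R.map cls).Nodup := by
    have := (Finset.Icc 1 n \ V).nodup
    rw [← h.cls_eq, Multiset.map_add] at this
    exact Multiset.nodup_of_le (Multiset.le_add_left _ _) this
  rw [← Multiset.cons_erase hp, Multiset.map_cons, Multiset.nodup_cons] at hnd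
  intro he
  exact hnd.1 (he ▸ Multiset.mem_map_of_mem cls hr)

theorem Splits.cls_notMem (h : Splits n d M V A R G) {r : BPoly} (hr : r ∈ R) : cls r ∉ V := by
  have : cls r ∈ (Finset.Icc 1 n \ V).val := by
    rw [← h.cls_eq]
    exact Multiset.mem_map_of_mem cls (Multiset.mem_add.2 (Or.inr hr))
  exact (Finset.mem_sdiff.1 (Finset.mem_def.2 this)).2

theorem filter_ne_empty_eq_self {S : Sys} (h : ∀ q ∈ S, 1 ≤ tdeg q) :
    S.filter (fun q => q ≠ ∅) = S :=
  Multiset.filter_eq_self.2 fun q hq => ne_empty_of_tdeg_pos (h q hq)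

theorem Splits.linear_subst (h : Splits n d M V A R G) {p r : BPoly} (hr : r ∈ R) (hp1 : tdeg p = 1)
    (hpV : VarsIn (Finset.Icc 1 n) p) (hne : cls r ≠ cls p) :
    cls (subst p r) = cls r ∧ tdeg (subst p r) = 1 ∧ VarsIn (Finset.Icc 1 n) (subst p r) := by
  have hl := h.linear r (Multiset.mem_add.2 (Or.inr hr))
  have := subst_linear hp1 hl.1 hne
  exact ⟨this.1, this.2, (hpV.subst hl.2).mono (Finset.erase_subset _ _)⟩

/-- Elimination of a variable outside of `V`. -/
theorem Splits.eliminate_linear (h : Splits n d M V A R G) (h0 : ∅ ∉ R + G) {p : BPoly}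
    (hp : p ∈ R) :
    (((R + G).erase p).map (subst p)).filter (fun q => q ≠ ∅) = (R.erase p).map (subst p) + G ∧
      Splits n d M V (p ::ₘ A) ((R.erase p).map (subst p)) G := by
  have hlp := h.linear p (Multiset.mem_add.2 (Or.inr hp))
  have hR : ∀ r ∈ R.erase p, _ := fun r hr =>
    h.linear_subst (Multiset.mem_of_mem_erase hr) hlp.1 hlp.2 (h.cls_ne hp hr)
  constructor
  · rw [Multiset.erase_add_left_pos _ hp, Multiset.map_add, Multiset.filter_add,
      filter_ne_empty_eq_self]
    · congr 1
      rw [Multiset.map_congr rfl fun g hg =>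
        subst_eq_self (h.varsIn g hg).1 (h.cls_notMem hp), Multiset.map_id']
      exact Multiset.filter_eq_self.2 fun q hq hq0 => h0 (hq0 ▸ Multiset.mem_add.2 (Or.inr hq))
    · intro q hq
      obtain ⟨r, hr, rfl⟩ := Multiset.mem_map.1 hq
      exact (hR r hr).2.1.ge
  · refine ⟨h.subset, ?_, fun q hq => ?_, h.varsIn, h.card_le⟩
    · have hcong : (R.erase p).map (cls ∘ subst p) = (R.erase p).map cls :=
        Multiset.map_congr rfl fun r hr => (hR r hr).1
      rw [← h.cls_eq, Multiset.cons_add, Multiset.map_cons, Multiset.map_add, Multiset.map_map,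
        hcong, ← Multiset.map_add, ← Multiset.map_cons,
        ← Multiset.add_cons, Multiset.cons_erase hp]
    · rcases Multiset.mem_add.1 hq with hq | hq
      · rcases Multiset.mem_cons.1 hq with rfl | hq
        · exact hlp
        · exact h.linear q (Multiset.mem_add.2 (Or.inl hq))
      · obtain ⟨r, hr, rfl⟩ := Multiset.mem_map.1 hq
        exact (hR r hr).2

/-- Elimination of a variable of `V`. -/
theorem Splits.eliminate_mem (h : Splits n d M V A R G) {p : BPoly} (hp : p ∈ G)
    (hp1 : tdeg p = 1) :
    ∃ G', (((R + G).erase p).map (subst p)).filter (fun q => q ≠ ∅) = R.map (subst p) + G' ∧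
      Splits n d M (V.erase (cls p)) (p ::ₘ A) (R.map (subst p)) G' := by
  have hpV := (h.varsIn p hp).1
  have hpI := hpV.mono h.subset
  have hc : cls p ∈ V := cls_mem hpV hp1.ge
  have hR : ∀ r ∈ R, _ := fun r hr =>
    h.linear_subst hr hp1 hpI fun he => h.cls_notMem hr (he ▸ hc)
  refine ⟨((G.erase p).map (subst p)).filter fun q => q ≠ ∅, ?_, ?_⟩
  · rw [Multiset.erase_add_right_pos _ hp, Multiset.map_add, Multiset.filter_add,
      filter_ne_empty_eq_self]
    intro q hq
    obtain ⟨r, hr, rfl⟩ := Multiset.mem_map.1 hq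
    exact (hR r hr).2.1.ge
  · refine ⟨(Finset.erase_subset _ _).trans h.subset, ?_, fun q hq => ?_, fun g hg => ?_, ?_⟩
    · have hcong : R.map (cls ∘ subst p) = R.map cls :=
        Multiset.map_congr rfl fun r hr => (hR r hr).1
      rw [Multiset.cons_add, Multiset.map_cons, Multiset.map_add, Multiset.map_map, hcong,
        ← Multiset.map_add, h.cls_eq,
        ← Finset.insert_val_of_notMem (by simp [hc])]
      congr 1
      ext x
      have := h.subset hc
      by_cases hx : x = cls p
      · subst hx; simpa using this
      · simp [hx]
    · rcases Multiset.mem_add.1 hq with hq | hq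
      · rcases Multiset.mem_cons.1 hq with rfl | hq
        · exact ⟨hp1, hpI⟩
        · exact h.linear q (Multiset.mem_add.2 (Or.inl hq))
      · obtain ⟨r, hr, rfl⟩ := Multiset.mem_map.1 hq
        exact (hR r hr).2
    · obtain ⟨q, hq, rfl⟩ := Multiset.mem_map.1 (Multiset.mem_filter.1 hg).1
      have hq' := h.varsIn q (Multiset.mem_of_mem_erase hq)
      exact ⟨hpV.subst hq'.1, (tdeg_subst_le hp1).trans hq'.2⟩
    · refine (Multiset.card_le_card (Multiset.filter_le _ _)).trans ?_
      rw [Multiset.card_map]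
      exact (Multiset.card_le_card (Multiset.erase_le _ _)).trans h.card_le

theorem Splits.addReduce_mem (h : Splits n d M V A R G) {Q : Sys} (hQ : Q ≤ G) {piv : ℕ → BPoly}
    (hpiv : IsPivot Q piv) {g : BPoly} (hg : g ∈ addReduce Q piv) : VarsIn V g ∧ tdeg g ≤ d := by
  have hm : ∀ q ∈ Q, VarsIn V q ∧ tdeg q ≤ d := fun q hq => h.varsIn q (Multiset.mem_of_le hQ hq)
  rcases mem_addReduce hpiv hg with hg | ⟨q, hq, p, hp, -, -, rfl, -⟩
  · exact hm g hg
  · exact ⟨(hm q hq).1.add (hm p hp).1,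
      (tdeg_add_le _ _).trans (max_le (hm q hq).2 (hm p hp).2)⟩

theorem empty_notMem_addReduce {Q : Sys} {piv : ℕ → BPoly} (hpiv : IsPivot Q piv) (h0 : ∅ ∉ Q) :
    ∅ ∉ addReduce Q piv := fun h => by
  rcases mem_addReduce hpiv h with h | ⟨_, _, _, _, _, _, _, h, _⟩
  · exact h0 h
  · exact h rfl

theorem Splits.roundBudget_addReduce (h : Splits n d M V A R G) (hmon : ∀ g ∈ G, IsMonic g)
    {piv : ℕ → BPoly} (hpiv : IsPivot G piv) {ρ : ℕ} (hr : RoundBudget n d V.card ρ G) :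
    RoundBudget n d V.card ρ (addReduce G piv) := fun hd => by
  obtain ⟨h1, h2⟩ := hr hd
  refine ⟨h1, Or.inr ?_⟩
  rcases h2 with ⟨g, hg, hn⟩ | ⟨j, hj, hc⟩
  · exact absurd (hmon g hg) hn
  · exact ⟨j, hj, fun c hcj => card_class_addReduce_le_one hpiv hmon
      (fun q hq => h.cls_pos hq (hmon q hq).tdeg_pos) hc hcj.le⟩

/-- A repeated class is at most `j` and positive, so `j ≥ 1`; the reduction makes class `j` unique,
and `j` can be lowered by one. -/
theorem Splits.roundBudget_main (h : Splits n d M V A R G) (hmon : ∀ g ∈ G, IsMonic g)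
    (hcls : ¬ (G.map cls).Nodup) (hd : 2 ≤ d)
    {piv : ℕ → BPoly} (hpiv : IsPivot G piv) {ρ : ℕ} (hr : RoundBudget n d V.card ρ G) :
    1 ≤ ρ ∧ RoundBudget n d V.card (ρ - 1) (addReduce G piv) := by
  have hpos : ∀ q ∈ G, 0 < cls q := fun q hq => h.cls_pos hq (hmon q hq).tdeg_pos
  obtain ⟨h1, ⟨g, hg, hn⟩ | ⟨j, hj, hc⟩⟩ := hr hd
  · exact absurd (hmon g hg) hn
  obtain ⟨c, hc2⟩ : ∃ c, 1 < Multiset.card (G.filter fun g => cls g = c) := by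
    rw [Multiset.nodup_iff_count_le_one] at hcls
    push Not at hcls
    obtain ⟨c, hcc⟩ := hcls
    refine ⟨c, ?_⟩
    rwa [Multiset.count_map, Multiset.filter_congr fun q _ => eq_comm] at hcc
  obtain ⟨q, hq⟩ := Multiset.card_pos_iff_exists_mem.1 (by omega :
    0 < Multiset.card (G.filter fun g => cls g = c))
  rw [Multiset.mem_filter] at hq
  have hq0 := hpos q hq.1
  have hcj : c ≤ j := by
    by_contra! hlt
    have := hc c hlt
    omega
  refine ⟨by omega, fun _ => ⟨by omega, Or.inr ⟨j - 1, by omega, fun e he => ?_⟩⟩⟩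
  exact card_class_addReduce_le_one hpiv hmon hpos hc (by omega)

/-- The effect of a zero decomposition on the budget. -/
theorem Splits.decompose (h : Splits n d M V A 0 G) {b : ℕ} (h0 : ∅ ∉ G) (h1 : one ∉ G)
    (hlin : (V.card - 1) * (d - 1) ≤ b ∨
      ∃ g ∈ G, 1 ≤ tdeg g ∧ ¬ IsMonic g ∧ (V.card - 2) * (d - 1) + (tdeg g - 1) ≤ b)
    {p : BPoly} (hp : p ∈ G) (hpm : ¬ IsMonic p)
    (hmin : ∀ q ∈ G, ¬ IsMonic q → tdeg p ≤ tdeg q)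
    (hgen : ¬ IsMonic (init p) ∨ tdeg (init p) = 1) :
    2 ≤ d ∧ 1 ≤ b ∧
      (Splits n d (M + 1) V 0 A (init p ::ₘ restAt (cls p) p ::ₘ G.erase p) ∧
        Budget d V.card (b - 1) (init p ::ₘ restAt (cls p) p ::ₘ G.erase p)) ∧
      Splits n d (M + 1) V A 0
        (add (var (cls p)) (restAt (cls p) p) ::ₘ add (init p) one ::ₘ G.erase p) ∧
      Budget d V.card (b - 1)
        (add (var (cls p)) (restAt (cls p) p) ::ₘ add (init p) one ::ₘ G.erase p) := by
  have hp1 : 1 ≤ tdeg p := tdeg_pos_of_ne (fun h => h0 (h ▸ hp)) (fun h => h1 (h ▸ hp))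
  have hi1 := tdeg_init_pos hp1 hpm
  have hi2 := tdeg_init_lt hp1
  obtain ⟨hpV, hpd⟩ := h.varsIn p hp
  have hV := hpV.tdeg_le_card
  -- The first alternative gives this too: `p` is non-monic, hence `V.card ≥ tdeg p ≥ 2`, and one
  -- factor `d - 1 ≥ tdeg p - 1` can be split off. In the second, `p` replaces `g` by minimality.
  have hb : (V.card - 2) * (d - 1) + (tdeg p - 1) ≤ b := by
    rcases hlin with hb | ⟨g, hg, -, hgm, hb⟩
    · rw [show V.card - 1 = V.card - 2 + 1 by omega, Nat.succ_mul] at hb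
      omega
    · have := hmin g hg hgm
      omega
  have hiV : VarsIn V (init p) := (hpV.coeffAt _).mono (Finset.erase_subset _ _)
  have hrV : VarsIn V (restAt (cls p) p) := (hpV.restAt _).mono (Finset.erase_subset _ _)
  have hrd := tdeg_restAt_le (cls p) p
  have hM : ∀ x y : BPoly, Multiset.card (x ::ₘ y ::ₘ G.erase p) ≤ M + 1 := fun x y => by
    have h1 := Multiset.card_erase_add_one hp
    have h2 := h.card_le
    simp only [Multiset.card_cons]
    omega
  have hG : ∀ g ∈ G.erase p, VarsIn V g ∧ tdeg g ≤ d := fun g hg =>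
    h.varsIn g (Multiset.mem_of_mem_erase hg)
  have hcV : VarsIn V (var (cls p)) := fun s hs => by
    rw [Finset.mem_singleton.1 hs]
    exact Finset.singleton_subset_iff.2 (cls_mem hpV hp1)
  have hcd : tdeg (var (cls p)) = 1 := by simp [tdeg, var]
  have hoV : VarsIn V one := fun s hs => by simp [Finset.mem_singleton.1 hs]
  refine ⟨by omega, by omega, ⟨⟨h.subset, ?_, ?_, ?_, hM _ _⟩, ?_⟩, h.replace ?_ (hM _ _), ?_⟩
  · rw [zero_add, ← h.cls_eq, add_zero]
  · intro q hq
    exact h.linear q (by simpa using hq)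
  · simp only [Multiset.mem_cons, forall_eq_or_imp]
    exact ⟨⟨hiV, by omega⟩, ⟨hrV, by omega⟩, hG⟩
  · exact Or.inr ⟨_, Multiset.mem_cons_self _ _, hi1, hgen, by omega⟩
  · simp only [Multiset.mem_cons, forall_eq_or_imp]
    refine ⟨⟨hcV.add hrV, (tdeg_add_le _ _).trans (max_le (by omega) (by omega))⟩,
      ⟨hiV.add hoV, ?_⟩, hG⟩
    rw [tdeg_add_one]
    omega
  · refine Or.inr ⟨_, Multiset.mem_cons_of_mem (Multiset.mem_cons_self _ _), ?_⟩
    rw [tdeg_add_one, isMonic_add_one]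
    exact ⟨hi1, hgen, by omega⟩

end Splits

/-! ### Cost bounds for systems of this shape -/

/-- Bound for a pass through `r` linear polynomials and `M` polynomials with at most `T` terms. -/
def scanBound (n r M T : ℕ) : ℕ := n + (r * (n * (n + 2)) + M * (n * (T + 1)))

/-- Bound for an elimination of a variable. -/
def eliminationBound (n d r M w : ℕ) : ℕ :=
  scanBound n r M (monomialCount w d) +
    (r * substBound n (n + 1) (n + 1) +
      M * substBound n (monomialCount w d) (monomialCount w (d - 1) * (w + 1)))

/-- Bound for each of the other steps. -/
def passBound (n d M w : ℕ) : ℕ :=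
  2 * scanBound n n M (monomialCount w d) + (M + n + 1) +
    ((n + 1) * scanBound n 0 M (monomialCount w d) + M * (2 * (n * (monomialCount w d + 1))))

theorem substBound_mono {n T K K' : ℕ} (h : K ≤ K') : substBound n T K ≤ substBound n T K' := by
  unfold substBound
  gcongr

section Cost

variable {n d M : ℕ} {V : Finset ℕ} {A R G : Sys}

theorem Splits.scan_le (h : Splits n d M V A R G) {L : Sys} {r w : ℕ} (hw : V.card ≤ w)
    (hL : ∀ p ∈ L, p ∈ A + R) (hr : Multiset.card L ≤ r) :
    scan n (L + G) ≤ scanBound n r M (monomialCount w d) := by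
  rw [scan, Multiset.map_add, Multiset.sum_add]
  exact Nat.add_le_add_left (Nat.add_le_add
    (sum_map_le (fun q hq => bits_le (h.card_linear_le (hL q hq))) hr)
    (sum_map_le (fun q hq => bits_le (h.card_le_of_mem hw hq)) h.card_le)) _

theorem Splits.addReduceCost_le (h : Splits n d M V A R G) {Q : Sys} (hQ : Q ≤ G) {w : ℕ}
    (hw : V.card ≤ w) {piv : ℕ → BPoly} (hpiv : IsPivot Q piv) :
    addReduceCost n Q piv ≤ (n + 1) * scanBound n 0 M (monomialCount w d) +
      M * (2 * (n * (monomialCount w d + 1))) := by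
  have := BCS.addReduceCost_le (n := n) hpiv
    (fun q hq => h.card_le_of_mem hw (Multiset.mem_of_le hQ hq))
    ((Multiset.card_le_card hQ).trans h.card_le)
  simpa [scanBound] using this

/-- The products are few for a reason that depends on where `p` and `q` lie: a linear `q` has a
constant coefficient at `x_c`; a `p` from `R` has a variable absent from `G`; a `p` from `G` has at
most `w + 1` terms, and the coefficients in `G` have degree at most `d - 1`. -/
theorem Splits.sum_substCost_le (h : Splits n d M V A R G) {p : BPoly} (hp : p ∈ R + G)
    (hp1 : tdeg p = 1) {r w : ℕ} (hw : V.card ≤ w) (hr : Multiset.card R ≤ r) :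
    (((R + G).erase p).map (substCost n p)).sum ≤ r * substBound n (n + 1) (n + 1) +
      M * substBound n (monomialCount w d) (monomialCount w (d - 1) * (w + 1)) := by
  have hpI : VarsIn (Finset.Icc 1 n) p := by
    rcases Multiset.mem_add.1 hp with hp | hp
    · exact (h.linear p (Multiset.mem_add.2 (Or.inr hp))).2
    · exact (h.varsIn p hp).1.mono h.subset
  have hpc : p.card ≤ n + 1 := by
    have := card_le_monomialCount hpI hp1.le
    rwa [Nat.card_Icc, Nat.add_sub_cancel, monomialCount_one] at this
  have herase : (((R + G).erase p).map (substCost n p)).sum ≤ ((R + G).map (substCost n p)).sum := by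
    rw [← Multiset.sum_map_erase hp]
    exact Nat.le_add_left _ _
  refine herase.trans ?_
  rw [Multiset.map_add, Multiset.sum_add]
  refine Nat.add_le_add (sum_map_le (fun q hq => ?_) hr) (sum_map_le (fun q hq => ?_) h.card_le)
  · have hq' := Multiset.mem_add.2 (Or.inr hq : q ∈ A ∨ q ∈ R)
    have hk : (coeffAt (cls p) q).card ≤ 1 := by
      have h1 := tdeg_coeffAt_le (cls p) q
      rw [(h.linear q hq').1] at h1
      have h2 := card_le_monomialCount ((h.linear q hq').2.coeffAt (cls p)) h1
      simpa [monomialCount] using h2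
    simpa using substCost_le (n := n) (h.card_linear_le hq') hk hpc
  · have hq' := h.varsIn q hq
    have hT := h.card_le_of_mem hw hq
    rcases Multiset.mem_add.1 hp with hp | hp
    · have hk : (coeffAt (cls p) q).card ≤ 0 := by
        rw [coeffAt_eq_empty hq'.1 (h.cls_notMem hp), Finset.card_empty]
      refine (substCost_le (n := n) hT hk hpc).trans (substBound_mono (by simp))
    · have hk : (coeffAt (cls p) q).card ≤ monomialCount w (d - 1) := by
        refine (card_le_monomialCount
          ((hq'.1.coeffAt (cls p)).mono (Finset.erase_subset _ _))
          ((tdeg_coeffAt_le _ _).trans (Nat.sub_le_sub_right hq'.2 1))).trans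
            (monomialCount_mono hw _)
      have hl : p.card ≤ w + 1 := by
        have := card_le_monomialCount (h.varsIn p hp).1 hp1.le
        rw [monomialCount_one] at this
        omega
      exact substCost_le (n := n) hT hk hl

end Cost

/-! ### Amortized analysis -/

/-- Bounds, in terms of the number `b` of zero decompositions that may still happen on a branch, for
the number of the remaining variables and for the number of reductions at a node, and a bound for the
number of the linear polynomials that a call of `TriSet` starts with. -/
structure Rates (n d : ℕ) where
  width : ℕ → ℕ
  rounds : ℕ → ℕ
  lin : ℕ
  width_spec : ∀ w b, w ≤ n → (w - 2) * (d - 1) ≤ b → w ≤ width b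
  rounds_spec : 2 ≤ d → ∀ b, n * (width b + 1) ≤ rounds b
  lin_spec : 2 ≤ d → n ≤ lin

section

variable {n d : ℕ} (Q : Rates n d) (m B : ℕ)

/-- The cost of an elimination at a node with budget `b`. -/
def Rates.elim (b : ℕ) : ℕ := eliminationBound n d Q.lin (m + B) (Q.width b)

/-- The cost of another step at a node with budget `b`. -/
def Rates.pass (b : ℕ) : ℕ := passBound n d (m + B) (Q.width b)

/-- The cost at a node with budget `b`. -/
def Rates.nodeCost (b : ℕ) : ℕ := n * Q.elim m B b + (3 * Q.rounds b + 4) * Q.pass m B b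

/-- The cost of the part of the zero decomposition tree below a node with budget `b`. -/
def Rates.treeCost : ℕ → ℕ
  | 0 => Q.nodeCost m B 0
  | b + 1 => Q.nodeCost m B (b + 1) + 2 * Rates.treeCost b

/-- The cost of the subtrees of the children of a node with budget `b`. -/
def Rates.childCost : ℕ → ℕ
  | 0 => 0
  | b + 1 => 2 * Q.treeCost m B b

theorem Rates.treeCost_eq (b : ℕ) :
    Q.treeCost m B b = Q.nodeCost m B b + Q.childCost m B b := by
  cases b <;> rfl

/-! ### The invariant of an execution. -/

/-- The state during `Simplify`. -/
def SimplifyOK (v : Node) (P A : Sys) (ρ : ℕ) : Prop :=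
  ∅ ∉ P ∧ ∃ V R G, P = R + G ∧ Splits n d (m + v.length) V A R G ∧
    Budget d V.card (B - v.length) G ∧ Multiset.card R ≤ Q.lin ∧ RoundBudget n d V.card ρ G

/-- The state after `Simplify`. -/
def StableOK (n d m B : ℕ) (v : Node) (P A : Sys) (ρ : ℕ) : Prop :=
  ∅ ∉ P ∧ one ∉ P ∧ (P ≠ 0 → 2 ≤ d) ∧ ∃ V, Splits n d (m + v.length) V A 0 P ∧
    ((V.card - 1) * (d - 1) ≤ B - v.length ∨ ∃ g ∈ P, 1 ≤ tdeg g ∧ ¬ IsMonic g ∧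
      (V.card - 2) * (d - 1) + (tdeg g - 1) ≤ B - v.length) ∧ RoundBudget n d V.card ρ P

def Phase.OK : Phase → Node → Sys → Sys → ℕ → Prop
  | .simplify => SimplifyOK Q m B
  | .threshold => StableOK n d m B
  | .main => StableOK n d m B

def Phase.weight : Phase → ℕ
  | .simplify => 3
  | .threshold => 2
  | .main => 1

/-- A state from which at most `ρ` reductions are possible at its node. -/
def StateOK (s : TState) (ρ : ℕ) : Prop :=
  s.node.length ≤ B ∧ s.nMonic ≤ m + n + s.node.length ∧ s.phase.OK Q m B s.node s.P s.A ρ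

/-- Bound for the cost of the rest of the tree below the node of a state. -/
def potential (s : TState) (ρ : ℕ) : ℕ :=
  (n - Multiset.card s.A) * Q.elim m B (B - s.node.length) +
    (3 * ρ + s.phase.weight) * Q.pass m B (B - s.node.length) +
    Q.childCost m B (B - s.node.length)

/-- A pending system. -/
def PendingOK (x : Node × Sys) : Prop :=
  x.1.length ≤ B ∧ ∃ V R G, x.2 = R + G ∧ Splits n d (m + x.1.length) V 0 R G ∧
    Budget d V.card (B - x.1.length) G ∧ Multiset.card R ≤ Q.lin

/-- `φ` bounds the cost of what the current call will still cause, and `κ` bounds its number of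
branches from below. -/
def CurOK : Option TState → ℕ → ℕ → Prop
  | none, _, _ => True
  | some s, φ, κ => (∃ ρ, StateOK Q m B s ρ ∧ potential Q m B s ρ ≤ φ) ∧ 2 ^ (B - s.node.length) ≤ κ

/-- The invariant of `BCS`. -/
def ConfigOK (c : Config) : Prop :=
  (∀ x ∈ c.pending, PendingOK Q m B x) ∧ (∀ v ∈ c.branches, v.length ≤ B) ∧
    ∃ φ κ, CurOK Q m B c.cur φ κ ∧
      c.cost + φ + (c.pending.map fun x => Q.treeCost m B (B - x.1.length)).sum ≤
        Q.treeCost m B B ∧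
      κ + (c.pending.map fun x => 2 ^ (B - x.1.length)).sum +
        (c.branches.map fun v => 2 ^ (B - v.length)).sum ≤ 2 ^ B

variable {Q m B}

/-- The last step of a call is paid from the potential, and the Kraft weight of the node passes to
the finished branch. -/
theorem ConfigOK.finish {W : Multiset (Node × Sys)} {s : TState} {L : Multiset Node}
    {O O' : Multiset Sys} {k k' : ℕ} (h : ConfigOK Q m B ⟨W, some s, L, O, k⟩)
    (hs : ∀ ρ, StateOK Q m B s ρ → k' ≤ k + potential Q m B s ρ) :
    ConfigOK Q m B ⟨W, none, s.node ::ₘ L, O', k'⟩ := by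
  obtain ⟨hW, hL, φ, κ, ⟨⟨ρ, hρ, hφ⟩, hκ⟩, hc, hk⟩ := h
  have := hs ρ hρ
  refine ⟨hW, fun v hv => ?_, 0, 0, trivial, ?_, ?_⟩
  · rcases Multiset.mem_cons.1 hv with rfl | hv
    · exact hρ.1
    · exact hL v hv
  · dsimp only at hc ⊢
    omega
  · dsimp only at hk ⊢
    rw [Multiset.map_cons, Multiset.sum_cons]
    omega

/-- Steps within a node leave the Kraft weights alone; only the amortized cost inequality has to be
checked. -/
theorem ConfigOK.advance {W : Multiset (Node × Sys)} {s s' : TState} {L : Multiset Node}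
    {O : Multiset Sys} {k k' : ℕ} (h : ConfigOK Q m B ⟨W, some s, L, O, k⟩)
    (hnode : s'.node = s.node)
    (hs : ∀ ρ, StateOK Q m B s ρ →
      ∃ ρ', StateOK Q m B s' ρ' ∧ k' + potential Q m B s' ρ' ≤ k + potential Q m B s ρ) :
    ConfigOK Q m B ⟨W, some s', L, O, k'⟩ := by
  obtain ⟨hW, hL, φ, κ, ⟨⟨ρ, hρ, hφ⟩, hκ⟩, hc, hk⟩ := h
  obtain ⟨ρ', hρ', hp⟩ := hs ρ hρ
  refine ⟨hW, hL, potential Q m B s' ρ', κ, ⟨⟨ρ', hρ', le_rfl⟩, hnode ▸ hκ⟩, ?_, hk⟩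
  dsimp only at hc ⊢
  omega

/-! ### Costs of the steps -/

theorem size_le_self (i : ℕ) : Nat.size i ≤ i := Nat.size_le.2 Nat.lt_two_pow_self

theorem Splits.width {V : Finset ℕ} {A R G : Sys} {M b : ℕ} (Q : Rates n d)
    (h : Splits n d M V A R G) (hb : (V.card - 2) * (d - 1) ≤ b) : V.card ≤ Q.width b :=
  Q.width_spec _ _ (by have := h.card_add; omega) hb

theorem Splits.weaken {V : Finset ℕ} {A R G : Sys} {l : ℕ}
    (h : Splits n d (m + l) V A R G) (hl : l ≤ B) : Splits n d (m + B) V A R G :=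
  h.replace h.varsIn (h.card_le.trans (by omega))

theorem Splits.scan_le_pass {V : Finset ℕ} {A R G : Sys} {b : ℕ} (h : Splits n d (m + B) V A R G)
    (hb : (V.card - 2) * (d - 1) ≤ b) : scan n (R + G) ≤ Q.pass m B b := by
  have h1 := h.scan_le (L := R) (h.width Q hb) (fun p hp => Multiset.mem_add.2 (Or.inr hp))
    (r := n) (by have := h.card_add; omega)
  unfold Rates.pass passBound
  omega

theorem Splits.main_le_pass {V : Finset ℕ} {A G : Sys} {b i : ℕ} (h : Splits n d (m + B) V A 0 G)
    (hb : (V.card - 2) * (d - 1) ≤ b) (hi : i ≤ m + n + B) :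
    scan n G + scan n (G + A) + (Nat.size i + 1) ≤ Q.pass m B b := by
  have h1 := h.scan_le (L := A) (h.width Q hb) (fun p hp => Multiset.mem_add.2 (Or.inl hp))
    (r := n) (by have := h.card_add; omega)
  have h2 := h.scan_le (L := 0) (h.width Q hb) (fun p hp => absurd hp (Multiset.notMem_zero p))
    (r := n) (by simp)
  have h3 := size_le_self i
  rw [add_comm A] at h1
  rw [zero_add] at h2
  unfold Rates.pass passBound
  omega

theorem Splits.reduce_le_pass {V : Finset ℕ} {A G S : Sys} {b i : ℕ}
    (h : Splits n d (m + B) V A 0 G)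
    (hb : (V.card - 2) * (d - 1) ≤ b) (hi : i ≤ m + n + B) (hS : S ≤ G) {piv : ℕ → BPoly}
    (hpiv : IsPivot S piv) :
    (Nat.size i + 1) + scan n G + addReduceCost n S piv ≤ Q.pass m B b := by
  have h1 := h.addReduceCost_le hS (h.width Q hb) hpiv
  have h2 := h.scan_le (L := 0) (h.width Q hb) (fun p hp => absurd hp (Multiset.notMem_zero p))
    (r := n) (by simp)
  have h3 := size_le_self i
  rw [zero_add] at h2
  unfold Rates.pass passBound
  omega

theorem StableOK.width {v : Node} {P A : Sys} {ρ : ℕ} (h : StableOK n d m B v P A ρ) :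
    ∃ V, Splits n d (m + v.length) V A 0 P ∧ (V.card - 2) * (d - 1) ≤ B - v.length := by
  obtain ⟨-, -, -, V, hV, hb, -⟩ := h
  refine ⟨V, hV, ?_⟩
  rcases hb with hb | ⟨g, -, -, -, hb⟩
  · exact (Nat.mul_le_mul_right _ (by omega)).trans hb
  · omega

/-! ### Preservation of the invariant -/

variable {v : Node} {P A : Sys} {i ρ k : ℕ}

/-- Going through the phases costs one pass each. Returning from `main` to `simplify` raises the
weight by two, so together with its own pass it uses the three units of one reduction. -/
theorem potential_step (Q : Rates n d) (m B : ℕ) (v : Node) (P P' A : Sys) (i i' ρ : ℕ)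
    (ph : Phase) :
    potential Q m B ⟨v, P, A, i, .simplify⟩ ρ =
      potential Q m B ⟨v, P', A, i', .threshold⟩ ρ + Q.pass m B (B - v.length) ∧
    potential Q m B ⟨v, P, A, i, .threshold⟩ ρ =
      potential Q m B ⟨v, P', A, i', .main⟩ ρ + Q.pass m B (B - v.length) ∧
    potential Q m B ⟨v, P, A, i, .main⟩ (ρ + 1) =
      potential Q m B ⟨v, P', A, i', .simplify⟩ ρ + Q.pass m B (B - v.length) ∧
    Q.pass m B (B - v.length) + Q.childCost m B (B - v.length) ≤
      potential Q m B ⟨v, P, A, i, ph⟩ ρ := by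
  simp only [potential, Phase.weight]
  refine ⟨by ring, by ring, by ring, ?_⟩
  have h1 : 1 ≤ 3 * ρ + ph.weight := by cases ph <;> simp [Phase.weight]
  have := Nat.mul_le_mul_right (Q.pass m B (B - v.length)) h1
  simp only [Phase.weight] at this ⊢
  omega

theorem pass_le_potential (Q : Rates n d) (m B : ℕ) (s : TState) (ρ : ℕ) :
    Q.pass m B (B - s.node.length) ≤ potential Q m B s ρ :=
  (Nat.le_add_right _ _).trans
    (potential_step Q m B s.node s.P s.P s.A s.nMonic s.nMonic ρ s.phase).2.2.2

/-- When no linear polynomial is left, `R` is empty, the witness in the budget must be non-monic,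
and any remaining polynomial has degree at least `2`. -/
theorem StateOK.simplifyDone (h : StateOK Q m B ⟨v, P, A, i, .simplify⟩ ρ) (h1 : one ∉ P)
    (hlin : ∀ p ∈ P, tdeg p ≠ 1) : StateOK Q m B ⟨v, P, A, i, .threshold⟩ ρ := by
  obtain ⟨hv, hi, h0, V, R, G, rfl, hs, hb, -, hr⟩ := h
  obtain rfl : R = 0 := Multiset.eq_zero_of_forall_notMem fun p hp =>
    hlin p (Multiset.mem_add.2 (Or.inl hp)) (hs.linear p (Multiset.mem_add.2 (Or.inr hp))).1
  dsimp only at h0 h1 hlin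
  rw [zero_add] at h0 h1 hlin
  refine ⟨hv, hi, ?_⟩
  dsimp only
  rw [zero_add]
  refine ⟨h0, h1, fun hne => ?_, V, hs, hb.imp_right ?_, hr⟩
  · obtain ⟨g, hg⟩ := Multiset.exists_mem_of_ne_zero hne
    have h2 := tdeg_pos_of_ne (fun h => h0 (h ▸ hg)) (fun h => h1 (h ▸ hg))
    have h3 := (hs.varsIn g hg).2
    have h4 := hlin g hg
    omega
  · rintro ⟨g, hg, hg1, hg2, hg3⟩
    exact ⟨g, hg, hg1, hg2.resolve_right (hlin g hg), hg3⟩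

theorem StateOK.eliminate (h : StateOK Q m B ⟨v, P, A, i, .simplify⟩ ρ) {p : BPoly} (hp : p ∈ P)
    (hp1 : tdeg p = 1) :
    StateOK Q m B
      ⟨v, ((P.erase p).map (subst p)).filter fun q => q ≠ ∅, p ::ₘ A, i, .simplify⟩ ρ ∧
    scan n P + ((P.erase p).map (substCost n p)).sum ≤ Q.elim m B (B - v.length) ∧
    Multiset.card A + 1 ≤ n := by
  obtain ⟨hv, hi, h0, V, R, G, rfl, hs, hb, hR, hr⟩ := h
  dsimp only at h0 hv hi hs hb hp hR ⊢
  have hcost : scan n (R + G) + (((R + G).erase p).map (substCost n p)).sum ≤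
      Q.elim m B (B - v.length) := by
    have hs' := hs.weaken hv
    have h1 := hs'.scan_le (L := R) (hs.width Q hb.width)
      (fun p hp => Multiset.mem_add.2 (Or.inr hp)) hR
    have h2 := hs'.sum_substCost_le hp hp1 (hs.width Q hb.width) hR
    unfold Rates.elim eliminationBound
    omega
  have h0' : ∅ ∉ (((R + G).erase p).map (subst p)).filter fun q => q ≠ ∅ := by simp
  rcases Multiset.mem_add.1 hp with hpR | hpG
  · obtain ⟨he, hs'⟩ := hs.eliminate_linear h0 hpR
    have hc := hs'.card_add
    rw [Multiset.card_cons] at hc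
    refine ⟨⟨hv, hi, h0', V, _, G, he, hs', hb, ?_, hr⟩, hcost, by omega⟩
    rw [Multiset.card_map]
    exact (Multiset.card_le_card (Multiset.erase_le _ _)).trans hR
  · obtain ⟨G', he, hs'⟩ := hs.eliminate_mem hpG hp1
    have hc := hs'.card_add
    rw [Multiset.card_cons] at hc
    have hcV : cls p ∈ V := cls_mem (hs.varsIn p hpG).1 hp1.ge
    have hcard := Finset.card_erase_add_one hcV
    refine ⟨⟨hv, hi, h0', _, _, G', he, hs', Or.inl ?_, by rwa [Multiset.card_map],
      hs'.roundBudget fun hd => ?_⟩, hcost, by omega⟩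
    -- The bound with `w - 2` is the first alternative for one variable fewer, whichever alternative
    -- held before.
    · rw [show (V.erase (cls p)).card - 1 = V.card - 2 by omega]
      exact hb.width
    -- The lost variable lowers `n * w` by `n`, which pays for resetting `j` to `n`.
    · have h1 := (hr hd).1
      rw [← hcard, Nat.mul_succ] at h1
      exact h1

/-- Non-monic polynomials are untouched, so the budget witness survives. If one exists, no entirely
monic reduction follows before the next decomposition; otherwise the uniqueness of the classes above
`j` is preserved. -/
theorem StateOK.thresholdReduce (h : StateOK Q m B ⟨v, P, A, i, .threshold⟩ ρ) {piv : ℕ → BPoly}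
    (hpiv : IsPivot (P.filter IsMonic) piv) (h1 : one ∉ addReduce (P.filter IsMonic) piv) :
    StateOK Q m B ⟨v, (P.filter fun q => ¬ IsMonic q) + addReduce (P.filter IsMonic) piv, A, i,
      .main⟩ ρ := by
  obtain ⟨hv, hi, h0, h1', hd, V, hs, hb, hr⟩ := h
  dsimp only at hv hi h0 h1' hd hs hb hr
  have hle : P.filter IsMonic ≤ P := Multiset.filter_le _ _
  have hkeep : ∀ g ∈ P, ¬ IsMonic g →
      g ∈ (P.filter fun q => ¬ IsMonic q) + addReduce (P.filter IsMonic) piv := fun g hg hm =>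
    Multiset.mem_add.2 (Or.inl (Multiset.mem_filter.2 ⟨hg, hm⟩))
  refine ⟨hv, hi, ?_, ?_, fun hne => hd ?_, V, hs.replace ?_ ?_, hb.imp_right ?_, ?_⟩
  · exact fun h => (Multiset.mem_add.1 h).elim (fun h => h0 (Multiset.mem_of_mem_filter h))
      (empty_notMem_addReduce hpiv fun h => h0 (Multiset.mem_of_mem_filter h))
  · exact fun h => (Multiset.mem_add.1 h).elim (fun h => h1' (Multiset.mem_of_mem_filter h)) h1
  · rintro rfl
    exact hne (by simp [addReduce])
  · intro g hg
    rcases Multiset.mem_add.1 hg with hg | hg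
    · exact hs.varsIn g (Multiset.mem_of_mem_filter hg)
    · exact hs.addReduce_mem hle hpiv hg
  · have h2 := card_addReduce_le hpiv
    have h3 := congrArg Multiset.card (Multiset.filter_add_not IsMonic P)
    have h4 := hs.card_le
    rw [Multiset.card_add] at h3 ⊢
    dsimp only
    omega
  · rintro ⟨g, hg, hg1, hg2, hg3⟩
    exact ⟨g, hkeep g hg hg2, hg1, hg2, hg3⟩
  · by_cases hmon : ∀ g ∈ P, IsMonic g
    · rw [Multiset.filter_eq_self.2 hmon] at hpiv ⊢
      rw [Multiset.filter_eq_nil.2 fun g hg h => h (hmon g hg), zero_add]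
      exact hs.roundBudget_addReduce hmon hpiv hr
    · push Not at hmon
      obtain ⟨g, hg, hm⟩ := hmon
      exact fun hd => ⟨(hr hd).1, Or.inl ⟨g, hkeep g hg hm, hm⟩⟩

/-- No non-monic witness exists here, so the first alternative of the budget holds, and it does not
depend on the polynomials. -/
theorem StateOK.mainReduce (h : StateOK Q m B ⟨v, P, A, i, .main⟩ ρ) {piv : ℕ → BPoly}
    (hmon : ∀ p ∈ P, IsMonic p) (hcls : ¬ (P.map cls).Nodup) (hpiv : IsPivot P piv) :
    1 ≤ ρ ∧ StateOK Q m B ⟨v, addReduce P piv, A, i, .simplify⟩ (ρ - 1) := by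
  obtain ⟨hv, hi, h0, h1', hd, V, hs, hb, hr⟩ := h
  dsimp only at hv hi h0 h1' hd hs hb hr
  have hd2 := hd fun hP => hcls (by simp [hP])
  have hr' := hs.roundBudget_main hmon hcls hd2 hpiv hr
  refine ⟨hr'.1, hv, hi, empty_notMem_addReduce hpiv h0, V, 0, _, (zero_add _).symm,
    hs.replace (fun g hg => hs.addReduce_mem le_rfl hpiv hg)
      ((card_addReduce_le hpiv).trans hs.card_le), Or.inl ?_, by simp, hr'.2⟩
  rcases hb with hb | ⟨g, hg, -, hg2, -⟩
  · exact hb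
  · exact absurd (hmon g hg) hg2

theorem StateOK.decompose (h : StateOK Q m B ⟨v, P, A, i, .main⟩ ρ) {p : BPoly} (hp : p ∈ P)
    (hpm : ¬ IsMonic p) (hmin : ∀ q ∈ P, ¬ IsMonic q → tdeg p ≤ tdeg q)
    (hgen : ¬ IsMonic (init p) ∨ tdeg (init p) = 1) :
    v.length + 1 ≤ B ∧
    PendingOK Q m B (v ++ [.right], init p ::ₘ restAt (cls p) p ::ₘ (P.erase p + A)) ∧
    StateOK Q m B ⟨v ++ [.left],
      add (var (cls p)) (restAt (cls p) p) ::ₘ add (init p) one ::ₘ P.erase p, A, i + 1,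
        .simplify⟩ (Q.rounds (B - (v.length + 1))) := by
  obtain ⟨hv, hi, h0, h1, hd, V, hs, hb, hr⟩ := h
  dsimp only at hv hi h0 h1 hd hs hb hr
  obtain ⟨hd2, hb1, ⟨hsr, hbr⟩, hsl, hbl⟩ := hs.decompose h0 h1 hb hp hpm hmin hgen
  have hlen : ∀ x : Side, (v ++ [x]).length = v.length + 1 := by simp
  have hb2 : B - v.length - 1 = B - (v.length + 1) := by omega
  have hA : Multiset.card A ≤ Q.lin := by
    have := hs.card_add
    have := Q.lin_spec hd2
    omega
  rw [hb2] at hbr hbl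
  rw [add_assoc] at hsr hsl
  refine ⟨by omega, ⟨?_, V, A,
    init p ::ₘ restAt (cls p) p ::ₘ P.erase p, ?_, ?_, ?_, hA⟩, ?_, ?_, ?_, V, 0, _, (zero_add _).symm,
    ?_, ?_, by simp, ?_⟩
  · simp only [hlen]; omega
  · dsimp only
    rw [add_comm A, Multiset.cons_add, Multiset.cons_add]
  · simpa only [hlen] using hsr
  · simpa only [hlen] using hbr
  · simp only [hlen]; omega
  · simp only [hlen]; omega
  · have hp1 : 1 ≤ tdeg p := tdeg_pos_of_ne (fun h => h0 (h ▸ hp)) (fun h => h1 (h ▸ hp))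
    have hi0 : add (init p) one ≠ ∅ := ne_empty_of_tdeg_pos (by
      rw [tdeg_add_one]
      exact tdeg_init_pos hp1 hpm)
    dsimp only
    rw [Multiset.mem_cons, Multiset.mem_cons]
    rintro (h | h | h)
    · exact cls_singleton_add_ne_empty _ _ h.symm
    · exact hi0 h.symm
    · exact h0 (Multiset.mem_of_mem_erase h)
  · simpa only [hlen] using hsl
  · simpa only [hlen] using hbl
  · refine hsl.roundBudget fun _ => ?_
    have h1 := Q.rounds_spec hd2 (B - (v.length + 1))
    have h2 := Nat.mul_le_mul_left n (hsl.width Q hbl.width)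
    rw [Nat.mul_succ] at h1
    omega

theorem PendingOK.select {Q : Rates n d} {m B : ℕ} {v : Node} {F : Sys}
    (h : PendingOK Q m B (v, F)) :
    StateOK Q m B ⟨v, F.filter fun q => q ≠ ∅, 0, F.countP IsMonic, .simplify⟩
      (Q.rounds (B - v.length)) ∧ scan n F ≤ Q.pass m B (B - v.length) := by
  obtain ⟨hv, V, R, G, hF, hs, hb, hR⟩ := h
  dsimp only at hv hF hs hb
  subst hF
  have hcard := hs.card_add
  rw [Multiset.card_zero] at hcard
  have hs' : Splits n d (m + v.length) V 0 R (G.filter fun q => q ≠ ∅) :=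
    hs.replace (fun g hg => hs.varsIn g (Multiset.mem_of_mem_filter hg))
      ((Multiset.card_le_card (Multiset.filter_le _ _)).trans hs.card_le)
  refine ⟨⟨hv, ?_, by simp, V, R, _, ?_, hs', ?_, hR, hs'.roundBudget fun hd => ?_⟩,
    (hs.weaken hv).scan_le_pass hb.width⟩
  · have h1 := Multiset.countP_le_card IsMonic (R + G)
    have h2 := hs.card_le
    rw [Multiset.card_add] at h1
    dsimp only
    omega
  · dsimp only
    rw [Multiset.filter_add, filter_ne_empty_eq_self]
    exact fun q hq => (hs.linear q (Multiset.mem_add.2 (Or.inr hq))).1.ge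
  · exact hb.of_mem fun g hg hg1 _ => Multiset.mem_filter.2 ⟨hg, ne_empty_of_tdeg_pos hg1⟩
  · have h1 := Q.rounds_spec hd (B - v.length)
    have h2 := Nat.mul_le_mul_left n (hs.width Q hb.width)
    rw [Nat.mul_succ] at h1
    omega

/-- The `4` in `nodeCost` is the weight `3` of `simplify` plus one pass for selecting the system. -/
theorem potential_entry (Q : Rates n d) (m B : ℕ) (v : Node) (P A : Sys) (i : ℕ) :
    potential Q m B ⟨v, P, A, i, .simplify⟩ (Q.rounds (B - v.length)) +
      Q.pass m B (B - v.length) ≤ Q.treeCost m B (B - v.length) := by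
  rw [Rates.treeCost_eq, Rates.nodeCost]
  simp only [potential, Phase.weight]
  have := Nat.mul_le_mul_right (Q.elim m B (B - v.length)) (Nat.sub_le n (Multiset.card A))
  have h : (3 * Q.rounds (B - v.length) + 4) * Q.pass m B (B - v.length) =
    (3 * Q.rounds (B - v.length) + 3) * Q.pass m B (B - v.length) +
      Q.pass m B (B - v.length) := by ring
  omega

theorem ConfigOK.step {t : ℕ∞} {choose : Sys → BPoly} (hch : IsLowestDegreeChoose choose)
    {c c' : Config} (h : ConfigOK Q m B c) (hgen : GenericChoice choose c)
    (hstep : Step n t choose c c') : ConfigOK Q m B c' := by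
  cases hstep with
  | select W v F L O k =>
    obtain ⟨hW, hL, φ, κ, -, hc, hk⟩ := h
    obtain ⟨hs, hcost⟩ := (hW _ (Multiset.mem_cons_self _ _)).select
    have hp := potential_entry Q m B v (F.filter fun q => q ≠ ∅) 0 (F.countP IsMonic)
    dsimp only at hc hk
    rw [Multiset.map_cons, Multiset.sum_cons] at hc hk
    refine ⟨fun x hx => hW x (Multiset.mem_cons_of_mem hx), hL, _, _, ⟨⟨_, hs, le_rfl⟩, le_rfl⟩,
      ?_, ?_⟩ <;> dsimp only at hc hk ⊢ <;> omega
  | simplifyContra W v P A i L O k h1 =>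
    refine h.finish fun ρ hρ => Nat.add_le_add_left ?_ _
    obtain ⟨hv, hi, h0, V, R, G, hP, hs, hb, -⟩ := hρ
    dsimp only at hP
    subst hP
    exact ((hs.weaken hv).scan_le_pass hb.width).trans (pass_le_potential Q m B _ _)
  | simplifyLinear W v P A i L O k p h1 hp hp1 =>
    refine h.advance rfl fun ρ hρ => ⟨ρ, (hρ.eliminate hp hp1).1, ?_⟩
    obtain ⟨-, h2, h3⟩ := hρ.eliminate hp hp1
    simp only [potential, Multiset.card_cons]
    have h4 : (n - Multiset.card A) * Q.elim m B (B - v.length) =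
        (n - (Multiset.card A + 1)) * Q.elim m B (B - v.length) + Q.elim m B (B - v.length) := by
      rw [← Nat.succ_mul]
      congr 1
      omega
    omega
  | simplifyDone W v P A i L O k h1 hlin =>
    refine h.advance rfl fun ρ hρ => ⟨ρ, hρ.simplifyDone h1 hlin, ?_⟩
    rw [(potential_step Q m B v P P A i i ρ .main).1]
    obtain ⟨hv, hi, h0, V, R, G, hP, hs, hb, -⟩ := hρ
    dsimp only at hP
    subst hP
    have := (hs.weaken hv).scan_le_pass (Q := Q) hb.width
    dsimp only at this
    omega
  | thresholdSkip W v P A i L O k ht =>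
    refine h.advance rfl fun ρ hρ => ⟨ρ, hρ, ?_⟩
    rw [(potential_step Q m B v P P A i i ρ .main).2.1]
    obtain ⟨V, hs, hb⟩ := StableOK.width hρ.2.2
    have := (hs.weaken hρ.1).main_le_pass (Q := Q) (i := i) hb
      (hρ.2.1.trans (Nat.add_le_add_left hρ.1 _))
    dsimp only at this
    omega
  | thresholdContra W v P A i L O k piv ht hpiv h1 =>
    refine h.finish fun ρ hρ => ?_
    rw [add_assoc, add_assoc, ← add_assoc _ (scan n P)]
    refine Nat.add_le_add_left ?_ _
    obtain ⟨V, hs, hb⟩ := StableOK.width hρ.2.2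
    exact ((hs.weaken hρ.1).reduce_le_pass (Q := Q) (i := i) hb
      (hρ.2.1.trans (Nat.add_le_add_left hρ.1 _)) (Multiset.filter_le _ _) hpiv).trans
        (pass_le_potential Q m B _ _)
  | thresholdReduce W v P A i L O k piv ht hpiv h1 =>
    refine h.advance rfl fun ρ hρ => ⟨ρ, hρ.thresholdReduce hpiv h1, ?_⟩
    rw [(potential_step Q m B v P ((P.filter fun q => ¬ IsMonic q) +
      addReduce (P.filter IsMonic) piv) A i i ρ .main).2.1]
    obtain ⟨V, hs, hb⟩ := StableOK.width hρ.2.2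
    have := (hs.weaken hρ.1).reduce_le_pass (Q := Q) (i := i) hb
      (hρ.2.1.trans (Nat.add_le_add_left hρ.1 _)) (Multiset.filter_le _ _) hpiv
    dsimp only at this
    omega
  | mainReturn W v P A i L O k hmon hcls =>
    refine h.finish fun ρ hρ => ?_
    rw [add_assoc]
    refine Nat.add_le_add_left ?_ _
    obtain ⟨V, hs, hb⟩ := StableOK.width hρ.2.2
    have h1 := ((hs.weaken hρ.1).main_le_pass (Q := Q) (i := i) hb
      (hρ.2.1.trans (Nat.add_le_add_left hρ.1 _))).trans (pass_le_potential Q m B _ ρ)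
    have h2 : scan n A ≤ scan n (P + A) := by simp [scan]
    dsimp only at h1
    omega
  | mainContra W v P A i L O k piv hmon hcls hpiv h1 =>
    refine h.finish fun ρ hρ => ?_
    rw [add_assoc]
    refine Nat.add_le_add_left ?_ _
    obtain ⟨V, hs, hb⟩ := StableOK.width hρ.2.2
    have h1 := ((hs.weaken hρ.1).reduce_le_pass (Q := Q) (i := i) hb
      (hρ.2.1.trans (Nat.add_le_add_left hρ.1 _)) le_rfl hpiv).trans
        (pass_le_potential Q m B _ ρ)
    dsimp only at h1
    omega
  | mainReduce W v P A i L O k piv hmon hcls hpiv h1 =>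
    refine h.advance rfl fun ρ hρ => ⟨ρ - 1, (hρ.mainReduce hmon hcls hpiv).2, ?_⟩
    obtain ⟨σ, rfl⟩ : ∃ σ, ρ = σ + 1 :=
      ⟨ρ - 1, by have := (hρ.mainReduce hmon hcls hpiv).1; omega⟩
    rw [(potential_step Q m B v P (addReduce P piv) A i i σ .main).2.2.1, Nat.add_sub_cancel]
    obtain ⟨V, hs, hb⟩ := StableOK.width hρ.2.2
    have := (hs.weaken hρ.1).reduce_le_pass (Q := Q) (i := i) hb
      (hρ.2.1.trans (Nat.add_le_add_left hρ.1 _)) le_rfl hpiv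
    dsimp only at this
    omega
  | decompose W v P A i L O k p hmon hp =>
    have hex : ∃ p ∈ P, ¬ IsMonic p := by simpa using hmon
    obtain ⟨hpP, hpm, hmin⟩ := hch P hex
    have hg := hgen _ rfl rfl hex
    dsimp only at hg
    rw [← hp] at hpP hpm hmin hg
    obtain ⟨hW, hL, φ, κ, ⟨⟨ρ, hρ, hφ⟩, hκ⟩, hc, hk⟩ := h
    obtain ⟨hv1, hpend, hst⟩ := hρ.decompose hpP hpm hmin hg
    have hpot := (potential_step Q m B v P P A i i ρ .main).2.2.2
    obtain ⟨V, hs, hb⟩ := StableOK.width hρ.2.2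
    have hcost := (hs.weaken hρ.1).main_le_pass (Q := Q) (i := i) hb
      (hρ.2.1.trans (Nat.add_le_add_left hρ.1 _))
    have hlen : ∀ x : Side, (v ++ [x]).length = v.length + 1 := by simp
    have hentry := potential_entry Q m B (v ++ [.left])
      (add (var (cls p)) (restAt (cls p) p) ::ₘ add (init p) one ::ₘ P.erase p) A (i + 1)
    have hb' : B - v.length = B - (v.length + 1) + 1 := by omega
    dsimp only at hc hk hφ hκ hcost
    refine ⟨fun x hx => ?_, hL, _, 2 ^ (B - (v.length + 1)), ⟨⟨_, hst, le_rfl⟩, ?_⟩, ?_, ?_⟩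
    · rcases Multiset.mem_cons.1 hx with rfl | hx
      · exact hpend
      · exact hW x hx
    · simp only [hlen]; exact le_rfl
    · dsimp only
      rw [Multiset.map_cons, Multiset.sum_cons]
      simp only [hlen] at hentry ⊢
      -- The reserve for the children splits evenly between the pending right child and the left
      -- child.
      have hchild : Q.childCost m B (B - v.length) =
          2 * Q.treeCost m B (B - (v.length + 1)) := by rw [hb']; rfl
      omega
    · dsimp only
      rw [Multiset.map_cons, Multiset.sum_cons]
      simp only [hlen]
      rw [hb', pow_succ] at hκ
      omega

theorem ConfigOK.start (Q : Rates n d) {F : Sys} (hF : InVars n F) (hd : sysDeg F = d) :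
    ConfigOK Q (Multiset.card F) ((d - 1) * (n - 1)) (start F) := by
  refine ⟨fun x hx => ?_, fun v hv => absurd hv (Multiset.notMem_zero v), 0, 0, trivial, ?_, ?_⟩
  · obtain rfl := Multiset.mem_singleton.1 hx
    refine ⟨Nat.zero_le _, Finset.Icc 1 n, 0, F, (zero_add _).symm, ⟨subset_rfl, ?_, ?_, ?_, ?_⟩,
      Or.inl ?_, Nat.zero_le _⟩
    · simp
    · intro p hp
      simp at hp
    · exact fun g hg => ⟨hF g hg, hd ▸ Multiset.le_sup (Multiset.mem_map_of_mem tdeg hg)⟩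
    · exact Nat.le_add_right _ _
    · rw [Nat.card_Icc, mul_comm]
      simp
  · simp [BCS.start]
  · simp [BCS.start]

/-- The number of branches, their depth and the cost of an execution. -/
theorem ConfigOK.bounds {c : Config} (h : ConfigOK Q m B c) :
    (∀ v ∈ c.branches, v.length ≤ B) ∧ Multiset.card c.branches ≤ 2 ^ B ∧
      c.cost ≤ Q.treeCost m B B := by
  obtain ⟨-, hL, φ, κ, -, hc, hk⟩ := h
  refine ⟨hL, ?_, by omega⟩
  have := Multiset.card_nsmul_le_sum (s := c.branches.map fun v => 2 ^ (B - v.length)) (a := 1)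
    (fun x hx => by
      obtain ⟨v, -, rfl⟩ := Multiset.mem_map.1 hx
      exact Nat.one_le_two_pow)
  rw [Multiset.card_map, smul_eq_mul, mul_one] at this
  omega

end

/-! ### Estimates -/

theorem monomialCount_le_two_pow (w k : ℕ) : monomialCount w k ≤ 2 ^ w := by
  rw [← Nat.sum_range_choose]
  have h : ∑ i ∈ Finset.range (w + 1), w.choose i =
      ∑ i ∈ Finset.range (w + 1 + (k + 1)), w.choose i := by
    refine Finset.sum_subset (Finset.range_mono (by omega)) fun i _ hi => ?_
    exact Nat.choose_eq_zero_of_lt (by simpa using hi)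
  rw [h]
  exact Finset.sum_le_sum_of_subset (Finset.range_mono (by omega))

theorem monomialCount_le_succ {w k l : ℕ} (h : k ≤ l) : monomialCount w k ≤ monomialCount w l :=
  Finset.sum_le_sum_of_subset (Finset.range_mono (by omega))

/-- With `l + 1` the ceiling, `2 ^ l ≤ n` and `2 ≤ n` give `l + 1 ≤ 2 * log n / log 2`, and `2 / log
2 < 3`. -/
theorem clog_le_log {n : ℕ} (hn : 2 ≤ n) : (Nat.clog 2 (n + 1) : ℝ) ≤ 3 * Real.log n := by
  have h1 : 2 ^ (Nat.clog 2 (n + 1)).pred < n + 1 := Nat.pow_pred_clog_lt_self (by norm_num) (by omega)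
  have hpos : 0 < Nat.clog 2 (n + 1) := Nat.clog_pos (by norm_num) (by omega)
  obtain ⟨l, hl⟩ : ∃ l, Nat.clog 2 (n + 1) = l + 1 := ⟨_, (Nat.succ_pred_eq_of_pos hpos).symm⟩
  rw [hl, Nat.pred_succ] at h1
  have h2 : (2 : ℝ) ^ l ≤ n := by exact_mod_cast Nat.lt_succ_iff.1 h1
  have h3 := Real.log_le_log (by positivity) h2
  rw [Real.log_pow] at h3
  have h4 : Real.log 2 ≤ Real.log n := Real.log_le_log (by norm_num) (by exact_mod_cast hn)
  have h5 := Real.log_two_gt_d9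
  rw [hl]
  push_cast
  nlinarith [(Nat.cast_nonneg l : (0 : ℝ) ≤ l)]

/-! ### The cost of a node. -/

/-- Polynomials of degree at most `1`. -/
def linearRates (n : ℕ) : Rates n 1 where
  width _ := n
  rounds _ := 0
  lin := 0
  width_spec _ _ h _ := h
  rounds_spec h := absurd h (by norm_num)
  lin_spec h := absurd h (by norm_num)

theorem treeCost_linearRates {n m : ℕ} (hn : 2 ≤ n) (hm : 1 ≤ m) :
    (linearRates n).treeCost m 0 0 ≤ 200 * (m * n ^ 3 * Nat.clog 2 (n + 1)) := by
  have hpos : 0 < Nat.clog 2 (n + 1) := Nat.clog_pos (by norm_num) (by omega)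
  simp only [Rates.treeCost, Rates.nodeCost, Rates.elim, Rates.pass, linearRates, passBound,
    eliminationBound, substBound, scanBound, monomialCount_one, Nat.sub_self]
  rw [show monomialCount n 0 = 1 by simp [monomialCount], one_mul]
  generalize Nat.clog 2 (n + 1) = L at *
  -- After shifting each variable by its lower bound, the difference of the two sides expands into a
  -- polynomial with nonnegative coefficients.
  obtain ⟨k, rfl⟩ := Nat.exists_eq_add_of_le hn
  obtain ⟨j, rfl⟩ := Nat.exists_eq_add_of_le hm
  obtain ⟨l, rfl⟩ := Nat.exists_eq_add_of_le hpos
  zify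
  rw [← sub_nonneg]
  ring_nf
  positivity

/-- Polynomials of higher degree. -/
def higherRates (n d : ℕ) (hd : 2 ≤ d) : Rates n d where
  width b := b / (d - 1) + 2
  rounds b := n * (b / (d - 1) + 2 + 1)
  lin := n
  width_spec w b _ h := by
    have := (Nat.le_div_iff_mul_le (by omega : 0 < d - 1)).2 h
    omega
  rounds_spec _ _ := le_rfl
  lin_spec _ := le_rfl

set_option maxRecDepth 20000 in
set_option maxHeartbeats 1000000 in
-- Here `W` bounds the number of variables, `T` the number of terms, `K` the number of products in a
-- substitution and `c` its logarithm; `L` stands for the logarithm of `n + 1`, and `m * n * d` for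
-- the number of polynomials. The powers of `W` come from the rounds and from the sorting of
-- products.
theorem nodeCost_aux {n d m L T W K c : ℕ} (hn : 2 ≤ n) (hd : 1 ≤ d) (hm : 1 ≤ m) (hL : 1 ≤ L)
    (hT : 1 ≤ T) (hK : K ≤ T * (W + 1)) (hc : c ≤ 2 * W) :
    n * (n + (n * (n * (n + 2)) + m * n * d * (n * (T + 1))) +
      (n * (n * (n + 1 + 1) + n * (n + 1) + n * (n + 1) * (L + 1) + n * (n + 1 + (n + 1))) +
        m * n * d * (n * (T + 1) + n * K + n * K * (c + 1) + n * (K + T)))) +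
    (3 * (n * (W + 1)) + 4) *
      (2 * (n + (n * (n * (n + 2)) + m * n * d * (n * (T + 1)))) + (m * n * d + n + 1) +
        ((n + 1) * (n + (0 * (n * (n + 2)) + m * n * d * (n * (T + 1)))) +
          m * n * d * (2 * (n * (T + 1))))) ≤
      100 * (d * m * n ^ 4 * L) * (T * (W + 3) ^ 2) := by
  calc _ ≤ n * (n + (n * (n * (n + 2)) + m * n * d * (n * (T + 1))) +
      (n * (n * (n + 1 + 1) + n * (n + 1) + n * (n + 1) * (L + 1) + n * (n + 1 + (n + 1))) +
        m * n * d * (n * (T + 1) + n * (T * (W + 1)) + n * (T * (W + 1)) * (2 * W + 1) +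
          n * (T * (W + 1) + T)))) +
    (3 * (n * (W + 1)) + 4) *
      (2 * (n + (n * (n * (n + 2)) + m * n * d * (n * (T + 1)))) + (m * n * d + n + 1) +
        ((n + 1) * (n + (0 * (n * (n + 2)) + m * n * d * (n * (T + 1)))) +
          m * n * d * (2 * (n * (T + 1))))) := by gcongr
    _ ≤ _ := by
      clear hK hc
      obtain ⟨k, rfl⟩ := Nat.exists_eq_add_of_le hn
      obtain ⟨j, rfl⟩ := Nat.exists_eq_add_of_le hm
      obtain ⟨l, rfl⟩ := Nat.exists_eq_add_of_le hL
      obtain ⟨e, rfl⟩ := Nat.exists_eq_add_of_le hd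
      obtain ⟨t, rfl⟩ := Nat.exists_eq_add_of_le hT
      zify
      rw [← sub_nonneg]
      ring_nf
      positivity

/-- Each decomposition adds one polynomial, so this bounds the size of every `G`. -/
theorem add_mul_sub_le {n d m : ℕ} (hn : 1 ≤ n) (hd : 1 ≤ d) (hm : 1 ≤ m) :
    m + (d - 1) * (n - 1) ≤ m * n * d := by
  obtain ⟨k, rfl⟩ := Nat.exists_eq_add_of_le hn
  obtain ⟨j, rfl⟩ := Nat.exists_eq_add_of_le hm
  obtain ⟨e, rfl⟩ := Nat.exists_eq_add_of_le hd
  simp only [Nat.add_sub_cancel_left]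
  zify
  rw [← sub_nonneg]
  ring_nf
  positivity

theorem nodeCost_higherRates {n d m : ℕ} (hn : 2 ≤ n) (hd : 2 ≤ d) (hm : 1 ≤ m) (b : ℕ) :
    (higherRates n d hd).nodeCost m ((d - 1) * (n - 1)) b ≤
      100 * (d * m * n ^ 4 * Nat.clog 2 (n + 1)) *
        (monomialCount (b / (d - 1) + 2) d * (b / (d - 1) + 2 + 3) ^ 2) := by
  have hL : 0 < Nat.clog 2 (n + 1) := Nat.clog_pos (by norm_num) (by omega)
  have hM := add_mul_sub_le (m := m) (by omega : 1 ≤ n) (by omega : 1 ≤ d) hm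
  simp only [Rates.nodeCost, Rates.elim, Rates.pass, higherRates, passBound,
    eliminationBound, substBound, scanBound]
  have hK := Nat.mul_le_mul_right (b / (d - 1) + 2 + 1)
    (monomialCount_le_succ (w := b / (d - 1) + 2) (Nat.sub_le d 1))
  have hT := monomialCount_pos (b / (d - 1) + 2) d
  have hc : Nat.clog 2 (monomialCount (b / (d - 1) + 2) (d - 1) * (b / (d - 1) + 2 + 1)) ≤
      2 * (b / (d - 1) + 2) := by
    refine Nat.clog_le_of_le_pow ?_
    rw [two_mul, pow_add]
    exact Nat.mul_le_mul (monomialCount_le_two_pow _ _) Nat.lt_two_pow_self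
  refine le_trans ?_ (nodeCost_aux hn (by omega) hm hL hT hK hc)
  generalize m + (d - 1) * (n - 1) = M at hM
  gcongr

/-! ### Summation over the tree. -/

/-- Since `(b + 11) / (b + 10) ≤ 11 / 10`, a polynomial factor of degree `p` costs at most `(11 /
10) ^ p` in the growth rate. -/
theorem pow_mul_add_ten_pow_le (p : ℕ) {r q : ℝ} (hr : 0 ≤ r) (hq : r * (11 / 10) ^ p ≤ q)
    (b : ℕ) : r ^ b * ((b : ℝ) + 10) ^ p ≤ 10 ^ p * q ^ b := by
  have hq0 : 0 ≤ q := le_trans (by positivity) hq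
  induction b with
  | zero => simp
  | succ b ih =>
    have h1 : ((b + 1 : ℕ) : ℝ) + 10 ≤ (11 / 10) * (b + 10) := by
      push_cast
      linarith [(Nat.cast_nonneg b : (0 : ℝ) ≤ b)]
    calc r ^ (b + 1) * (((b + 1 : ℕ) : ℝ) + 10) ^ p
        ≤ r ^ (b + 1) * ((11 / 10) * (b + 10)) ^ p := by gcongr
      _ = (r * (11 / 10) ^ p) * (r ^ b * ((b : ℝ) + 10) ^ p) := by rw [mul_pow]; ring
      _ ≤ q * (10 ^ p * q ^ b) := by gcongr
      _ = 10 ^ p * q ^ (b + 1) := by ring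

/-- For `d = 2` there are up to `b + 2` variables, but only quadratically many monomials. For `d ≥
3` the number of variables is at most `b / 2 + 2`, and even all `2 ^ w` monomials grow only like `√2
^ b`. -/
theorem sizes_le {d : ℕ} (hd : 2 ≤ d) (b : ℕ) :
    ((monomialCount (b / (d - 1) + 2) d * (b / (d - 1) + 2 + 3) ^ 2 : ℕ) : ℝ) ≤
      10 ^ 4 * (7 / 4) ^ b := by
  rcases hd.eq_or_lt with rfl | hd
  · have h1 : monomialCount (b + 2) 2 ≤ (b + 10) ^ 2 := by
      have : (b + 2).choose 2 ≤ (b + 2) ^ 2 := Nat.choose_le_pow _ _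
      simp only [monomialCount, Finset.sum_range_succ, Finset.sum_range_zero, Nat.choose_zero_right,
        Nat.choose_one_right]
      nlinarith
    have h2 : monomialCount (b + 2) 2 * (b + 2 + 3) ^ 2 ≤ (b + 10) ^ 2 * (b + 10) ^ 2 :=
      Nat.mul_le_mul h1 (Nat.pow_le_pow_left (by omega) 2)
    have h3 := pow_mul_add_ten_pow_le 4 (r := 1) (q := 7 / 4) (by norm_num) (by norm_num) b
    have h4 : ((monomialCount (b + 2) 2 * (b + 2 + 3) ^ 2 : ℕ) : ℝ) ≤ ((b : ℝ) + 10) ^ 4 := by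
      refine (Nat.cast_le.2 h2).trans (le_of_eq ?_)
      push_cast
      ring
    rw [one_pow, one_mul] at h3
    simpa using h4.trans h3
  · have hw : b / (d - 1) ≤ b / 2 := Nat.div_le_div_left (by omega) (by norm_num)
    have h2 : monomialCount (b / (d - 1) + 2) d * (b / (d - 1) + 2 + 3) ^ 2 ≤
        2 ^ (b / 2 + 2) * (b / 2 + 10) ^ 2 :=
      Nat.mul_le_mul ((monomialCount_le_two_pow _ _).trans
        (Nat.pow_le_pow_right (by norm_num) (by omega))) (Nat.pow_le_pow_left (by omega) 2)
    have h3 := pow_mul_add_ten_pow_le 2 (r := 2) (q := (7 / 4) ^ 2) (by norm_num) (by norm_num)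
      (b / 2)
    rw [← pow_mul] at h3
    have h5 : (7 / 4 : ℝ) ^ (2 * (b / 2)) ≤ (7 / 4) ^ b :=
      pow_le_pow_right₀ (by norm_num) (Nat.mul_div_le b 2)
    refine (Nat.cast_le.2 h2).trans ?_
    push_cast at h3 ⊢
    rw [pow_add]
    nlinarith [pow_pos (by norm_num : (0 : ℝ) < 7 / 4) b]

/-- The right-hand side solves the recursion with node cost `x * (7 / 4) ^ b` exactly; any rate
below `2` would give a bound of order `2 ^ b`. -/
theorem treeCost_le_of_nodeCost_le {n d m B : ℕ} {Q : Rates n d} {x : ℝ}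
    (h : ∀ b, (Q.nodeCost m B b : ℝ) ≤ x * (7 / 4) ^ b) (b : ℕ) :
    (Q.treeCost m B b : ℝ) ≤ x * (8 * 2 ^ b - 7 * (7 / 4) ^ b) := by
  induction b with
  | zero => simpa [Rates.treeCost] using (h 0).trans (by norm_num)
  | succ b ih =>
    have h1 := h (b + 1)
    rw [Rates.treeCost]
    push_cast
    rw [pow_succ] at h1 ⊢
    rw [pow_succ]
    linarith

theorem treeCost_bound {n d m : ℕ} (hn : 2 ≤ n) (hd : 1 ≤ d) (hm : 1 ≤ m) :
    ∃ Q : Rates n d, (Q.treeCost m ((d - 1) * (n - 1)) ((d - 1) * (n - 1)) : ℝ) ≤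
      (3 * 10 ^ 7) * (2 ^ ((n - 1) * (d - 1)) * d * m * (n : ℝ) ^ (d + 2) * Real.log n) := by
  have hlog := clog_le_log hn
  have hlog0 : 0 ≤ Real.log n := Real.log_natCast_nonneg n
  rcases hd.eq_or_lt with rfl | hd
  · refine ⟨linearRates n, ?_⟩
    simp only [Nat.sub_self, zero_mul, mul_zero, pow_zero, one_mul, Nat.cast_one]
    have h1 : ((linearRates n).treeCost m 0 0 : ℝ) ≤
        200 * (m * (n : ℝ) ^ 3 * Nat.clog 2 (n + 1)) := by
      exact_mod_cast treeCost_linearRates hn hm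
    calc _ ≤ _ := h1
      _ ≤ 200 * (m * (n : ℝ) ^ 3 * (3 * Real.log n)) := by gcongr
      _ = 600 * (m * (n : ℝ) ^ (1 + 2) * Real.log n) := by ring
      _ ≤ _ := by
        gcongr
        norm_num
  · refine ⟨higherRates n d hd, ?_⟩
    rw [mul_comm (n - 1)]
    have hnode : ∀ b, ((higherRates n d hd).nodeCost m ((d - 1) * (n - 1)) b : ℝ) ≤
        100 * (d * m * (n : ℝ) ^ 4 * Nat.clog 2 (n + 1)) * 10 ^ 4 * (7 / 4) ^ b := fun b => by
      refine (Nat.cast_le.2 (nodeCost_higherRates hn hd hm b)).trans ?_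
      rw [Nat.cast_mul _ (_ * _), mul_assoc _ (10 ^ 4 : ℝ)]
      refine mul_le_mul (by push_cast; exact le_rfl) (sizes_le hd b) (by positivity)
        (by positivity)
    have h1 := treeCost_le_of_nodeCost_le hnode ((d - 1) * (n - 1))
    have hn1 : (1 : ℝ) ≤ n := by exact_mod_cast (by omega : 1 ≤ n)
    calc _ ≤ _ := h1
      _ ≤ 100 * (d * m * (n : ℝ) ^ 4 * Nat.clog 2 (n + 1)) * 10 ^ 4 *
          (8 * 2 ^ ((d - 1) * (n - 1))) := by
        gcongr
        exact sub_le_self _ (by positivity)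
      -- The exponent `d + 2` enters only through `n ^ 4 ≤ n ^ (d + 2)`.
      _ ≤ 100 * (d * m * (n : ℝ) ^ (d + 2) * (3 * Real.log n)) * 10 ^ 4 *
          (8 * 2 ^ ((d - 1) * (n - 1))) := by
        gcongr
        omega
      _ = (24 * 10 ^ 6) * (2 ^ ((d - 1) * (n - 1)) * d * m * (n : ℝ) ^ (d + 2) * Real.log n) := by
        ring
      _ ≤ _ := by
        exact mul_le_mul_of_nonneg_right (by norm_num) (by positivity)

/-! ### Executions and the main theorem. -/

theorem IsExecution.configOK {n d : ℕ} (Q : Rates n d) {t : ℕ∞} {choose : Sys → BPoly} {F : Sys}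
    (hF : InVars n F) (hd : sysDeg F = d) (hch : IsLowestDegreeChoose choose) {e : ℕ → Config}
    {N : ℕ} (he : IsExecution n t choose F e N) (hgen : ∀ i < N, GenericChoice choose (e i)) :
    ∀ i ≤ N, ConfigOK Q (Multiset.card F) ((d - 1) * (n - 1)) (e i) := by
  intro i
  induction i with
  | zero => exact fun _ => he.1 ▸ ConfigOK.start Q hF hd
  | succ i ih => exact fun hi => (ih (by omega)).step hch (hgen i hi) (he.2 i hi)

theorem IsExecution.le_cost {n : ℕ} (hn : 1 ≤ n) {t : ℕ∞} {choose : Sys → BPoly} {F : Sys}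
    {e : ℕ → Config} {N : ℕ} (he : IsExecution n t choose F e N) :
    ∀ i ≤ N, i ≤ (e i).cost := by
  intro i
  induction i with
  | zero => exact fun _ => Nat.zero_le _
  | succ i ih =>
    intro hi
    have h1 := ih (by omega)
    have h2 := (he.2 i hi).cost_lt hn
    omega

end BCS

theorem mainTheorem3 :
    ∃ C : ℝ, 0 < C ∧
      ∀ (n d m : ℕ) (t : ℕ∞) (choose : BCS.Sys → BCS.BPoly) (F : BCS.Sys),
        2 ≤ n → 1 ≤ d → BCS.InVars n F → BCS.sysDeg F = d → Multiset.card F = m →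
        BCS.IsLowestDegreeChoose choose →
        ∀ (e : ℕ → BCS.Config) (N : ℕ),
          BCS.IsExecution n t choose F e N →
          (∀ i < N, BCS.GenericChoice choose (e i)) →
            -- every step costs at least one bit operation, and only a final configuration is stuck
            N ≤ (e N).cost ∧
            ((e N).IsFinal ∨ ∃ c : BCS.Config, BCS.Step n t choose (e N) c) ∧
            -- the depth and the number of the branches of the zero decomposition tree
            (∀ v ∈ (e N).branches, v.length ≤ (d - 1) * (n - 1)) ∧
            Multiset.card (e N).branches ≤ 2 ^ ((d - 1) * (n - 1)) ∧
            -- the bit complexity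
            ((e N).cost : ℝ) ≤
              C * (2 ^ ((n - 1) * (d - 1)) * d * m * (n : ℝ) ^ (d + 2) * Real.log n) := by
  refine ⟨3 * 10 ^ 7, by norm_num, ?_⟩
  intro n d m t choose F hn hd hF hdeg hm hch e N he hgen
  -- The empty system has degree `0`, which `1 ≤ d` excludes.
  have hm1 : 1 ≤ m := by
    rw [← hm, Nat.one_le_iff_ne_zero, Ne, Multiset.card_eq_zero]
    rintro rfl
    simp [BCS.sysDeg] at hdeg
    omega
  obtain ⟨Q, hQ⟩ := BCS.treeCost_bound hn hd hm1
  have hOK := he.configOK Q hF hdeg hch hgen N le_rfl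
  rw [hm] at hOK
  obtain ⟨h1, h2, h3⟩ := hOK.bounds
  exact ⟨he.le_cost (by omega) N le_rfl, BCS.isFinal_or_exists_step n t choose _, h1, h2,
    (Nat.cast_le.2 h3).trans hQ⟩
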